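/- Let $\mathcal X$ be a projective, non-singular, geometrically irreducible curve over a finite field $\mathbb F_q$ with function field $F=\mathbb F_q(\mathcal X)$, let $Q$ be a rational point, and let $P_1,\dots,P_l$ be distinct rational points different from $Q$; put $D=\sum_{i=1}^l P_i$. Write $L(mQ)=\{f\in F: f=0\text{ or }(f)+mQ\ge 0\}$, $L(\infty Q)=\bigcup_{m\ge 0}L(mQ)$, $ev_D(f)=(f(P_1),\dots,f(P_l))$, $C(D,mQ)=ev_D(L(mQ))$, and let $H(Q)=\{-v_Q(f): 0\ne f\in L(\infty Q)\}$ be the Weierstrass semigroup of $Q$. A *kernel* constructed from $D$ and $Q$ is an $l\times l$ matrix over $\mathbb F_q$ whose rows form a basis of $\mathbb F_q^l$ and whose $i$-th row is $ev_D(f_i)$ for some $f_i\in L(m_iQ)\setminus L(m_{i-1}Q)$, where $m_1<\dots<m_l$ are the elements of $H^*(Q)=\{m\in\mathbb N_0: C(D,(m-1)Q)\ne C(D,mQ)\}$ (for $i=1$ the condition is $f_1\in L(m_1Q)$). Let $x_1,\dots,x_r\in L(\infty Q)$ be nonzero functions whose pole orders $a_j=-v_Q(x_j)$ generate the semigroup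 $H(Q)$, let $R=\mathbb F_q[t_1,\dots,t_r]$, and let $I$ be the kernel of $R\to F$, $t_j\mapsto x_j$. Suppose that $z\in F$ has divisor $(z)=D-lQ$, and that $z'\in F$ has divisor $(z')=\sum_{i=1}^sP_{k_i}-sQ$ with $k_i\ne k_j$ for $i\ne j$; put $D'=\sum_{i=1}^sP_{k_i}$. Let $f_z,f_{z'}\in R$ represent $z,z'$, that is, $f_z(x_1,\dots,x_r)=z$ and $f_{z'}(x_1,\dots,x_r)=z'$. Let $\varphi:\mathbb F_q^l\to\mathbb F_q^s$, $c\mapsto(c_{k_1},\dots,c_{k_s})$, be the puncturing to $\operatorname{supp} D'$. Then: 1. The natural map $\psi:R/\langle I,f_z\rangle\to R/\langle I,f_{z'}\rangle$, $p\mapsto p$, and the evaluation maps $ev_D:R/\langle I,f_z\rangle\to\mathbb F_q^l$ and $ev_{D'}:R/\langle I,f_{z'}\rangle\to\mathbb F_q^s$, $p\mapsto ev(p(x_1,\dots,x_r))$, are well-defined homomorphisms of $\mathbb F_q$-algebras, and $\varphi\circ ev_D=ev_{D'}\circ\psi$. 2. There are row indices $i_1<\dots<i_s$ such that, for every kernel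 $G$ constructed from $D$ and $Q$, the submatrix of $G$ with rows $i_1,\dots,i_s$ and columns $k_1,\dots,k_s$ is a kernel constructed from $D'$ and $Q$; and every kernel $G'$ constructed from $D'$ and $Q$ is this submatrix of some kernel $G$ constructed from $D$ and $Q$. 3. Let a monomial order on $R$ be given that compares first the weights, where $t_j$ has weight $a_j$. For an ideal $J$ let $\Delta(J)$ be the set of the monomials that are not the leading monomial of a nonzero element of $J$. Then $\Delta(\langle I,f_z\rangle)$ consists of $l$ monomials of distinct weights, their evaluations at $P_1,\dots,P_l$ (with $t_j=x_j$), listed as rows by increasing weight, form a kernel $G$ constructed from $D$ and $Q$; in the same way $\Delta(\langle I,f_{z'}\rangle)$ gives a kernel $G'$ constructed from $D'$ and $Q$; and $G'$ is the submatrix of $G$ with the rows $i_1,\dots,i_s$ of part 2 and the columns $k_1,\dots,k_s$. -/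

import Mathlib

open scoped WithZero

noncomputable section

/-- `F` is the function field of a projective, non-singular, geometrically irreducible curve over
the perfect field `k`: `F / k` is a finitely generated field extension of transcendence degree
one, and `k` is algebraically closed in `F`. -/
structure IsCurveFunctionField (k F : Type*) [Field k] [Field F] [Algebra k F] : Prop where
  fg : (⊤ : IntermediateField k F).FG
  trdeg_eq_one : Algebra.trdeg k F = 1
  full_constants : ∀ f : F, IsAlgebraic k f → f ∈ Set.range (algebraMap k F)

/-- A place (closed point) of the curve with function field `F`: a normalized (that is,
surjective) discrete valuation of `F` that is trivial on `k`. -/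
structure CurvePlace (k F : Type*) [Field k] [Field F] [Algebra k F] where
  /-- the multiplicatively written valuation -/
  v : Valuation F ℤᵐ⁰
  surjective : Function.Surjective v
  trivial_on : ∀ c : k, c ≠ 0 → v (algebraMap k F c) = 1

namespace CurvePlace

variable {k F : Type*} [Field k] [Field F] [Algebra k F]

/-- The order of vanishing of `f ≠ 0` at the place `P` (the value at `f = 0` is meaningless). -/
def ord (P : CurvePlace k F) (f : F) : ℤ := -WithZero.log (P.v f)

/-- `P` is rational (of degree one): the constants map onto the residue field of `P`. -/
def IsRational (P : CurvePlace k F) : Prop :=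
  ∀ f : F, P.v f ≤ 1 → ∃ c : k, P.v (f - algebraMap k F c) < 1

open scoped Classical in
/-- The value `f(P) ∈ k` of a function `f` that is regular at the rational place `P`: the constant
`c` such that `f - c` vanishes at `P` (and `0` when there is no such constant). -/
def value (P : CurvePlace k F) (f : F) : k :=
  if h : ∃ c : k, P.v (f - algebraMap k F c) < 1 then h.choose else 0

theorem v_algebraMap_le_one (P : CurvePlace k F) (c : k) : P.v (algebraMap k F c) ≤ 1 := by
  by_cases hc : c = 0
  · simp [hc]
  · exact (P.trivial_on c hc).le

end CurvePlace

section AGCodes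

variable {k F : Type*} [Field k] [Field F] [Algebra k F]

/-- Divisors on the curve. -/
abbrev CurveDivisor (k F : Type*) [Field k] [Field F] [Algebra k F] : Type _ :=
  CurvePlace k F →₀ ℤ

/-- `(f) = E`: the function `f` is nonzero and its principal divisor is `E`. -/
def HasDivisor (f : F) (E : CurveDivisor k F) : Prop :=
  f ≠ 0 ∧ ∀ R : CurvePlace k F, R.ord f = E R

/-- The divisor `P₁ + ⋯ + Pₗ`. -/
def pointsDivisor {l : ℕ} (P : Fin l → CurvePlace k F) : CurveDivisor k F :=
  ∑ i, Finsupp.single (P i) 1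

/-- The divisor `m Q`. -/
def multDivisor (m : ℤ) (Q : CurvePlace k F) : CurveDivisor k F := Finsupp.single Q m

/-- The Riemann-Roch space `L(A)` of the `f` with `f = 0` or `(f) + A ≥ 0`; since
`R.v f = exp (-R.ord f)` for `f ≠ 0`, the condition at `R` reads `R.v f ≤ exp (A R)`. -/
def riemannRochSpace (A : CurveDivisor k F) : Submodule k F where
  carrier := {f | ∀ R : CurvePlace k F, R.v f ≤ WithZero.exp (A R)}
  zero_mem' R := by simp
  add_mem' {f g} hf hg R := (R.v.map_add f g).trans (max_le (hf R) (hg R))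
  smul_mem' c f hf R := by
    rw [Algebra.smul_def, map_mul]
    exact (mul_le_mul_left (R.v_algebraMap_le_one c) _).trans (by simpa using hf R)

theorem mem_riemannRochSpace_iff (A : CurveDivisor k F) (f : F) :
    f ∈ riemannRochSpace A ↔ f = 0 ∨ ∀ R : CurvePlace k F, 0 ≤ R.ord f + A R := by
  by_cases hf : f = 0
  · simp [hf]
  · simp only [hf, false_or]
    refine forall_congr' fun R => ?_
    have h : R.v f ≠ 0 := (Valuation.ne_zero_iff _).2 hf
    rw [CurvePlace.ord, ← WithZero.log_le_iff_le_exp h]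
    constructor <;> intro _ <;> linarith

/-- The ring `L(∞Q)`, the union of the `L(mQ)` for `m ≥ 0`. -/
def ringAtInfinity (Q : CurvePlace k F) : Subalgebra k F where
  carrier := {f | ∃ m : ℕ, f ∈ riemannRochSpace (multDivisor (m : ℤ) Q)}
  mul_mem' {f g} := by
    rintro ⟨m, hf⟩ ⟨n, hg⟩
    refine ⟨m + n, fun R => ?_⟩
    have h := mul_le_mul' (hf R) (hg R)
    rw [map_mul]
    refine h.trans (le_of_eq ?_)
    rw [← WithZero.exp_add]
    simp [multDivisor, Finsupp.single_add]
  add_mem' {f g} := by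
    rintro ⟨m, hf⟩ ⟨n, hg⟩
    have key : ∀ a b : ℕ, a ≤ b → riemannRochSpace (multDivisor (a : ℤ) Q) ≤
        riemannRochSpace (multDivisor (b : ℤ) Q) := fun a b hab u hu R =>
      (hu R).trans (WithZero.exp_le_exp.2 (by
        classical
        simp only [multDivisor, Finsupp.single_apply]
        split_ifs <;> simp [hab]))
    exact ⟨max m n, Submodule.add_mem _ (key _ _ (le_max_left _ _) hf)
      (key _ _ (le_max_right _ _) hg)⟩
  algebraMap_mem' c := ⟨0, fun R => by
    simpa [multDivisor] using R.v_algebraMap_le_one c⟩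

/-- The Weierstrass semigroup `H(Q)`: the pole orders at `Q` of the functions in `L(∞Q)`. -/
def weierstrassSemigroup (Q : CurvePlace k F) : Set ℕ :=
  {m | ∃ f ∈ ringAtInfinity Q, f ≠ 0 ∧ Q.ord f = -(m : ℤ)}

/-- The evaluation map `ev_D`, for `D = P₁ + ⋯ + Pₗ`. -/
def evalAt {l : ℕ} (P : Fin l → CurvePlace k F) (f : F) : Fin l → k := fun i => (P i).value f

/-- The evaluation code `C(D, A) = ev_D(L(A))`, for `D = P₁ + ⋯ + Pₗ`. -/
def evalCode {l : ℕ} (P : Fin l → CurvePlace k F) (A : CurveDivisor k F) : Set (Fin l → k) :=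
  evalAt P '' (riemannRochSpace A : Set F)

/-- The set `H*(Q)` of the `m ≥ 0` with `C(D, (m - 1)Q) ≠ C(D, mQ)`. -/
def hStar {l : ℕ} (P : Fin l → CurvePlace k F) (Q : CurvePlace k F) : Set ℕ :=
  {m | evalCode P (multDivisor ((m : ℤ) - 1) Q) ≠ evalCode P (multDivisor (m : ℤ) Q)}

/-- `G` is a kernel associated to the pointed curve and `D = P₁ + ⋯ + Pₗ`: with
`H*(Q) = {m₁ < ⋯ < mₗ}`, its `i`-th row is `ev_D(fᵢ)` for some `fᵢ ∈ L(mᵢQ) \ L(mᵢ₋₁Q)`, and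
the rows form a basis of `k ^ l`. -/
def IsKernel {l : ℕ} (P : Fin l → CurvePlace k F) (Q : CurvePlace k F)
    (G : Matrix (Fin l) (Fin l) k) : Prop :=
  ∃ (m : Fin l → ℕ) (f : Fin l → F),
    StrictMono m ∧ Set.range m = hStar P Q ∧
    (∀ i, f i ∈ riemannRochSpace (multDivisor (m i : ℤ) Q)) ∧
    (∀ i j, j < i → f i ∉ riemannRochSpace (multDivisor (m j : ℤ) Q)) ∧
    (∀ i, G i = evalAt P (f i)) ∧
    LinearIndependent k (fun i => G i)

/-- The ideal `I` of the polynomial relations between `x₁, …, xᵣ`. -/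
def relationIdeal {r : ℕ} (x : Fin r → F) : Ideal (MvPolynomial (Fin r) k) :=
  RingHom.ker (MvPolynomial.aeval (R := k) x)

/-- The ideal `⟨I, f⟩`. -/
def relationIdealWith {r : ℕ} (x : Fin r → F) (f : MvPolynomial (Fin r) k) :
    Ideal (MvPolynomial (Fin r) k) :=
  relationIdeal x ⊔ Ideal.span {f}

/-- The footprint `Δ(J)`: the exponents of the monomials that are not the leading monomial of a
nonzero element of `J`. -/
def footprint {r : ℕ} (mo : MonomialOrder (Fin r)) (J : Ideal (MvPolynomial (Fin r) k)) :
    Set (Fin r →₀ ℕ) :=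
  {u | ∀ p ∈ J, p ≠ 0 → mo.degree p ≠ u}

/-- The weight of `T ^ u` when the variable `tⱼ` has weight `aⱼ`. -/
def monomialWeight {r : ℕ} (a : Fin r → ℕ) (u : Fin r →₀ ℕ) : ℕ := ∑ j, u j * a j

/-- The monomial order `mo` compares weights first (ties being broken in some way). -/
def RefinesWeight {r : ℕ} (mo : MonomialOrder (Fin r)) (a : Fin r → ℕ) : Prop :=
  ∀ u w : Fin r →₀ ℕ, monomialWeight a u < monomialWeight a w → mo.toSyn u < mo.toSyn w

/-- `G` is the matrix of the evaluations at `P₁, …, Pₗ` of the monomials `M₁, …, Mₗ` in the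
footprint of `J`, listed by increasing weight, with `x₁, …, xᵣ` put for the variables. -/
def IsFootprintMatrix {r l : ℕ} (mo : MonomialOrder (Fin r)) (a : Fin r → ℕ) (x : Fin r → F)
    (J : Ideal (MvPolynomial (Fin r) k)) (P : Fin l → CurvePlace k F)
    (G : Matrix (Fin l) (Fin l) k) : Prop :=
  ∃ M : Fin l → (Fin r →₀ ℕ),
    Set.range M = footprint mo J ∧ StrictMono (fun i => monomialWeight a (M i)) ∧
    ∀ i, G i = evalAt P (MvPolynomial.aeval x (MvPolynomial.monomial (M i) (1 : k)))

end AGCodes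

end

noncomputable section

/-! ### Zeros and poles: every nonconstant function vanishes at some place -/

section Places

open Polynomial

variable {k F : Type*} [Field k] [Field F] [Algebra k F]

/-! Everything is governed by the ring A = L(∞Q) and pole orders at Q. Evaluation at D is an algebra
map A → k^l, and since the zeros of z are exactly the points of D, each simple, its kernel is zA
(`evalHom_eq_zero_iff`). As z has pole order l, this gives H*(Q) = H(Q) \ (l + H(Q))
(`mem_hStar_iff`): a function whose pole order is m = n + l can be replaced, modulo a multiple of z,
by one of smaller pole order, and for any other m in H(Q) no function of pole order m evaluates to
zero. Evaluation is onto (`evalHom_surjective`), so H*(Q) has l elements. The kernels are then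
exactly the matrices of evaluations of functions whose pole orders are the elements of H*(Q) in
increasing order.

For part 1, A is also the image of R, and ⟨I, f_z⟩ is the preimage of zA
(`mem_relationIdealWith_iff`). Since z vanishes on D', z = z'y with y in A, so the ideal for z lies
in that for z'.

For part 2, the same factorization gives H* for D' inside H* for D (`hStar_comp_subset`). The rows
i_1 < ⋯ < i_s are the positions of the smaller set in the larger one; they depend only on pole
orders, hence serve all kernels at once.

For part 3, the footprint consists of the smallest monomial of each weight in H*
(`mem_footprint_iff`). The choice of that monomial does not involve the divisor, so the footprint
for D' is part of the footprint for D, in the same rows.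

The geometric inputs are that a function without poles is constant
(`IsCurveFunctionField.constant_of_regular`) and that A separates the points of D
(`exists_separating`). Both are obtained from valuation theory, without Riemann-Roch. -/

theorem IsCurveFunctionField.isTranscendenceBasis (hF : IsCurveFunctionField k F) {h : F}
    (hh : Transcendental k h) : IsTranscendenceBasis k (fun _ : Unit => h) :=
  (algebraicIndependent_unique_type_iff.2 hh).isTranscendenceBasis_of_lift_trdeg_le_of_finite
    (by simp [hF.trdeg_eq_one])

theorem IsCurveFunctionField.transcendental (hF : IsCurveFunctionField k F) {f : F}
    (hf : f ∉ Set.range (algebraMap k F)) : Transcendental k f :=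
  fun h => hf (hF.full_constants f h)

theorem IsCurveFunctionField.finiteDimensional (hF : IsCurveFunctionField k F) {h : F}
    (hh : Transcendental k h) : FiniteDimensional (IntermediateField.adjoin k {h}) F := by
  have h1 : Algebra.IsAlgebraic (IntermediateField.adjoin k {h}) F := by
    have := (hF.isTranscendenceBasis hh).isAlgebraic_field
    rwa [Set.range_const] at this
  have h2 : Algebra.EssFiniteType k F := IntermediateField.fg_top_iff.1 hF.fg
  have h3 : Algebra.EssFiniteType (IntermediateField.adjoin k {h}) F :=
    Algebra.EssFiniteType.of_comp k _ F
  exact Algebra.finite_of_essFiniteType_of_isAlgebraic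

/-- An element `u` of the function field satisfies a polynomial equation over `k[h]` whose
coefficients do not all vanish at `h = 0`. -/
theorem IsCurveFunctionField.exists_relation (hF : IsCurveFunctionField k F) {h : F}
    (hh : Transcendental k h) (u : F) :
    ∃ (n : ℕ) (a : ℕ → k[X]), ∑ j ∈ Finset.range n, aeval h (a j) * u ^ j = 0 ∧
      ∃ j < n, (a j).coeff 0 ≠ 0 := by
  have hh0 : h ≠ 0 := by rintro rfl; exact hh (isAlgebraic_zero)
  have h1 : Algebra.IsAlgebraic (Algebra.adjoin k {h}) F := by
    have := (hF.isTranscendenceBasis hh).isAlgebraic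
    rwa [Set.range_const] at this
  obtain ⟨p, hp0, hp⟩ := h1.isAlgebraic u
  have hmem : ∀ q : k[X], aeval h q ∈ Algebra.adjoin k {h} := fun q => by
    rw [Algebra.adjoin_singleton_eq_range_aeval]; exact ⟨q, rfl⟩
  let φ : k[X] →ₐ[k] Algebra.adjoin k {h} := (aeval h).codRestrict _ hmem
  have hφ : Function.Surjective (φ : k[X] →+* Algebra.adjoin k {h}) := by
    rintro ⟨c, hc⟩
    rw [Algebra.adjoin_singleton_eq_range_aeval] at hc
    obtain ⟨q, rfl⟩ := hc
    exact ⟨q, rfl⟩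
  obtain ⟨P, rfl⟩ := Polynomial.map_surjective _ hφ p
  have hP0 : P ≠ 0 := by rintro rfl; simp at hp0
  have hP : eval₂ ((aeval h : k[X] →ₐ[k] F) : k[X] →+* F) u P = 0 := by
    rw [← hp, aeval_def, eval₂_map]
    rfl
  have hCX : ¬ IsUnit (C X : k[X][X]) := by
    rw [isUnit_C]; exact not_isUnit_X
  -- Dividing by the highest power of the inner variable, which stands for h, leaves some
  -- coefficient with nonzero constant term. The relation survives because h ≠ 0.
  obtain ⟨P', hP', hnd⟩ :=
    (FiniteMultiplicity.of_not_isUnit hCX hP0).exists_eq_pow_mul_and_not_dvd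
  rw [hP', eval₂_mul, eval₂_pow, eval₂_C] at hP
  have hP2 : eval₂ ((aeval h : k[X] →ₐ[k] F) : k[X] →+* F) u P' = 0 := by
    refine (mul_eq_zero.1 hP).resolve_left (pow_ne_zero _ ?_)
    simpa using hh0
  refine ⟨P'.natDegree + 1, P'.coeff, ?_, ?_⟩
  · rw [eval₂_eq_sum_range] at hP2
    exact hP2
  · by_contra! hcon
    apply hnd
    rw [C_dvd_iff_dvd_coeff]
    intro j
    rw [X_dvd_iff]
    by_cases hj : j < P'.natDegree + 1
    · exact hcon j hj
    · rw [coeff_eq_zero_of_natDegree_lt (p := P') (by omega), coeff_zero]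

theorem Valuation.map_aeval_le_one {Γ : Type*} [LinearOrderedCommGroupWithZero Γ]
    (w : Valuation F Γ) (hk : ∀ c : k, w (algebraMap k F c) ≤ 1) {h : F} (hh : w h ≤ 1)
    (p : k[X]) : w (aeval h p) ≤ 1 := by
  rw [aeval_eq_sum_range]
  refine w.map_sum_le fun i _ => ?_
  rw [Algebra.smul_def, map_mul, map_pow]
  exact mul_le_one' (hk _) (pow_le_one' hh _)

theorem Valuation.map_aeval_eq_one {Γ : Type*} [LinearOrderedCommGroupWithZero Γ]
    (w : Valuation F Γ) (hk : ∀ c : k, c ≠ 0 → w (algebraMap k F c) = 1) {h : F} (hh : w h < 1)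
    {p : k[X]} (hp : p.coeff 0 ≠ 0) : w (aeval h p) = 1 := by
  have hk' : ∀ c : k, w (algebraMap k F c) ≤ 1 := fun c => by
    by_cases hc : c = 0
    · simp [hc]
    · exact (hk c hc).le
  rw [← divX_mul_X_add p]
  simp only [map_add, map_mul, aeval_X, aeval_C]
  rw [w.map_add_eq_of_lt_right, hk _ hp]
  rw [hk _ hp, map_mul]
  exact (mul_le_of_le_one_left' (w.map_aeval_le_one hk' hh.le _)).trans_lt hh

theorem Valuation.exists_map_aeval_eq_pow {Γ : Type*} [LinearOrderedCommGroupWithZero Γ]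
    (w : Valuation F Γ) (hk : ∀ c : k, c ≠ 0 → w (algebraMap k F c) = 1) {h : F} (hh : w h < 1)
    {p : k[X]} (hp : p ≠ 0) : ∃ n : ℕ, w (aeval h p) = w h ^ n := by
  obtain ⟨q, hq, hnd⟩ :=
    (FiniteMultiplicity.of_not_isUnit (not_isUnit_X (R := k)) hp).exists_eq_pow_mul_and_not_dvd
  refine ⟨multiplicity X p, ?_⟩
  rw [congrArg (aeval h) hq, map_mul, map_pow, map_mul, map_pow, aeval_X,
    w.map_aeval_eq_one hk hh (fun h0 => hnd (X_dvd_iff.2 h0)), mul_one]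

/-- The maximal value in a vanishing sum must be attained twice, since a single dominant term cannot
be cancelled. -/
theorem Valuation.exists_map_eq_of_sum_eq_zero {Γ : Type*} [LinearOrderedCommGroupWithZero Γ]
    (w : Valuation F Γ) {n : ℕ} {f : ℕ → F} (hsum : ∑ j ∈ Finset.range n, f j = 0)
    (hne : ∃ j < n, f j ≠ 0) : ∃ i j, i < j ∧ j < n ∧ f j ≠ 0 ∧ w (f i) = w (f j) := by
  classical
  obtain ⟨j₀, hj₀, hf₀⟩ := hne
  obtain ⟨j, hj, hmax⟩ := (Finset.range n).exists_max_image (fun j => w (f j))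
    ⟨j₀, Finset.mem_range.2 hj₀⟩
  have hfj : f j ≠ 0 := by
    intro h0
    have := hmax j₀ (Finset.mem_range.2 hj₀)
    rw [h0, map_zero] at this
    exact hf₀ (w.zero_iff.1 (le_antisymm this zero_le))
  by_cases hex : ∃ i ∈ Finset.range n, i ≠ j ∧ w (f i) = w (f j)
  · obtain ⟨i, hi, hij, he⟩ := hex
    rcases lt_or_gt_of_ne hij with hlt | hlt
    · exact ⟨i, j, hlt, Finset.mem_range.1 hj, hfj, he⟩
    · refine ⟨j, i, hlt, Finset.mem_range.1 hi, ?_, he.symm⟩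
      rw [← w.ne_zero_iff, he]
      exact w.ne_zero_iff.2 hfj
  · push Not at hex
    exfalso
    have hlt : ∀ i ∈ (Finset.range n).erase j, w (f i) < w (f j) := fun i hi =>
      lt_of_le_of_ne (hmax i (Finset.mem_of_mem_erase hi))
        (hex i (Finset.mem_of_mem_erase hi) (Finset.ne_of_mem_erase hi))
    have h1 := w.map_sum_lt (w.ne_zero_iff.2 hfj) hlt
    rw [← Finset.add_sum_erase _ _ hj] at hsum
    rw [← neg_eq_of_add_eq_zero_right hsum, w.map_neg] at h1
    exact lt_irrefl _ h1

/-- Over a valuation of `k(h)` with `h` in the maximal ideal, the values of all elements of `F`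
are commensurable with the value of `h`, with a bounded denominator. -/
theorem IsCurveFunctionField.exists_zpow_eq (hF : IsCurveFunctionField k F) {h : F}
    (hh : Transcendental k h) {Γ : Type*} [LinearOrderedCommGroupWithZero Γ] (w : Valuation F Γ)
    (hk : ∀ c : k, c ≠ 0 → w (algebraMap k F c) = 1) (hlt : w h < 1) :
    ∃ N : ℕ, 0 < N ∧ ∀ u : F, u ≠ 0 → ∃ e : ℤ, w u ^ N = w h ^ e := by
  have := hF.finiteDimensional hh
  set K := IntermediateField.adjoin k {h}
  have hh0 : h ≠ 0 := by rintro rfl; exact hh isAlgebraic_zero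
  have hwh : w h ≠ 0 := w.ne_zero_iff.2 hh0
  -- On k(h) all values are powers of w(h), because a polynomial in h is a power of h times a unit.
  have hK : ∀ c : K, c ≠ 0 → ∃ e : ℤ, w (c : F) = w h ^ e := by
    rintro ⟨c, hc⟩ hc0
    have hc0 : c ≠ 0 := fun h => hc0 (Subtype.ext h)
    obtain ⟨r, s, rfl⟩ := IntermediateField.mem_adjoin_simple_iff k c |>.1 hc
    have hr : r ≠ 0 := by rintro rfl; simp at hc0
    have hs : s ≠ 0 := by rintro rfl; simp at hc0
    obtain ⟨m, hm⟩ := w.exists_map_aeval_eq_pow hk hlt hr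
    obtain ⟨n, hn⟩ := w.exists_map_aeval_eq_pow hk hlt hs
    refine ⟨(m : ℤ) - n, ?_⟩
    simp only [map_div₀]
    rw [hm, hn, zpow_sub₀ hwh, zpow_natCast, zpow_natCast]
  -- Two terms of the minimal polynomial of u with equal value put w(u)^(j - i) into the value group
  -- of k(h). Since 0 < j - i ≤ [F : k(h)], the factorial is a common exponent for all u.
  refine ⟨(Module.finrank K F).factorial, Nat.factorial_pos _, fun u hu => ?_⟩
  have hint : IsIntegral K u := Algebra.IsIntegral.isIntegral u
  have hsum := minpoly.aeval K u
  rw [aeval_eq_sum_range] at hsum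
  obtain ⟨i, j, hij, hjn, hfj, he⟩ := w.exists_map_eq_of_sum_eq_zero hsum
    ⟨(minpoly K u).natDegree, Nat.lt_succ_self _, by
      rw [coeff_natDegree, (minpoly.monic hint).leadingCoeff, one_smul]
      exact pow_ne_zero _ hu⟩
  have hwu : w u ≠ 0 := w.ne_zero_iff.2 hu
  simp only [Algebra.smul_def, map_mul, map_pow] at he
  have hcj : (minpoly K u).coeff j ≠ 0 := by
    intro h0; simp [h0] at hfj
  obtain ⟨ej, hej⟩ := hK _ hcj
  have hej' : w (algebraMap K F ((minpoly K u).coeff j)) = w h ^ ej := hej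
  have hci : (minpoly K u).coeff i ≠ 0 := by
    intro h0
    rw [h0, map_zero, map_zero, zero_mul, hej'] at he
    exact mul_ne_zero (zpow_ne_zero _ hwh) (pow_ne_zero _ hwu) he.symm
  obtain ⟨ei, hei⟩ := hK _ hci
  have hei' : w (algebraMap K F ((minpoly K u).coeff i)) = w h ^ ei := hei
  rw [hej', hei'] at he
  have hdiff : w u ^ (j - i) = w h ^ (ei - ej) := by
    obtain ⟨d, rfl⟩ := Nat.exists_eq_add_of_lt hij
    rw [show i + d + 1 - i = d + 1 by omega, zpow_sub₀ hwh, eq_div_iff (zpow_ne_zero _ hwh)]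
    rw [show i + d + 1 = i + (d + 1) by ring, pow_add] at he
    refine mul_right_cancel₀ (pow_ne_zero i hwu) ?_
    rw [he]; ac_rfl
  have hle : j - i ≤ Module.finrank K F := by
    have := minpoly.natDegree_le (A := K) u
    omega
  obtain ⟨q, hq⟩ := Nat.dvd_factorial (by omega : 0 < j - i) hle
  refine ⟨(ei - ej) * q, ?_⟩
  rw [hq, pow_mul, hdiff, zpow_mul, zpow_natCast]

/-- A valuation all of whose values are powers of the value of `π`, `v(π) < 1`, is equivalent to
a normalized discrete valuation. -/
theorem Valuation.exists_normalized {Γ : Type*} [LinearOrderedCommGroupWithZero Γ]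
    (w : Valuation F Γ) {π : F} (hπ0 : π ≠ 0) (hπ : w π < 1)
    (hpow : ∀ u : F, u ≠ 0 → ∃ n : ℤ, w u = w π ^ n) :
    ∃ v : Valuation F ℤᵐ⁰, Function.Surjective v ∧ ∀ a b : F, v a ≤ v b ↔ w a ≤ w b := by
  classical
  have hwπ : 0 < w π := (w.pos_iff).2 hπ0
  choose! e he using hpow
  have hanti : StrictAnti (fun n : ℤ => w π ^ n) := zpow_right_strictAnti₀ hwπ hπ
  have e_unique : ∀ {u : F} {n : ℤ}, u ≠ 0 → w u = w π ^ n → e u = n := fun hu hn =>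
    hanti.injective ((he _ hu).symm.trans hn)
  let v₀ : F → ℤᵐ⁰ := fun u => if u = 0 then 0 else WithZero.exp (-e u)
  have v₀_le : ∀ a b : F, v₀ a ≤ v₀ b ↔ w a ≤ w b := by
    intro a b
    by_cases ha : a = 0
    · simp [v₀, ha]
    by_cases hb : b = 0
    · have : 0 < w a := w.pos_iff.2 ha
      simp [v₀, ha, hb]
    · simp only [v₀, ha, hb, if_false, WithZero.exp_le_exp, neg_le_neg_iff]
      rw [he a ha, he b hb, hanti.le_iff_ge]
  let v : Valuation F ℤᵐ⁰ :=
    { toFun := v₀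
      map_zero' := by simp [v₀]
      map_one' := by
        have : e 1 = 0 := e_unique one_ne_zero (by simp)
        simp [v₀, this]
      map_mul' := fun a b => by
        by_cases ha : a = 0
        · simp [v₀, ha]
        by_cases hb : b = 0
        · simp [v₀, hb]
        have : e (a * b) = e a + e b := e_unique (mul_ne_zero ha hb) (by
          rw [map_mul, zpow_add₀ hwπ.ne', ← he a ha, ← he b hb])
        simp only [v₀, ha, hb, mul_eq_zero, or_self, if_false, this, neg_add, WithZero.exp_add]
      map_add_le_max' := fun a b => by
        rcases le_total (w a) (w b) with hab | hab
        · exact le_max_of_le_right ((v₀_le _ _).2 (w.map_add_le hab le_rfl))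
        · exact le_max_of_le_left ((v₀_le _ _).2 (w.map_add_le le_rfl hab)) }
  refine ⟨v, fun y => ?_, v₀_le⟩
  induction y using WithZero.expRecOn with
  | zero => exact ⟨0, map_zero v⟩
  | exp n =>
    refine ⟨π ^ (-n), ?_⟩
    have h0 : π ^ (-n) ≠ 0 := zpow_ne_zero _ hπ0
    have : e (π ^ (-n)) = -n := e_unique h0 (map_zpow₀ w _ _)
    change v₀ _ = _
    simp only [v₀, h0, if_false, this, neg_neg]

/-- As h is not invertible in k[h], some valuation ring of F contains k[h] and has h as a nonunit.
Its value group is commensurable with the powers of w(h) with bounded denominator, hence infinite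
cyclic, so the valuation can be normalized. -/
theorem IsCurveFunctionField.exists_place_lt_one (hF : IsCurveFunctionField k F) {h : F}
    (hh : Transcendental k h) : ∃ R : CurvePlace k F, R.v h < 1 := by
  have hh0 : h ≠ 0 := by rintro rfl; exact hh isAlgebraic_zero
  let A : Subring F := (Algebra.adjoin k {h}).toSubring
  let hA : A := ⟨h, Algebra.subset_adjoin rfl⟩
  have hI : Ideal.span {hA} ≠ ⊤ := by
    rw [Ne, Ideal.span_singleton_eq_top]
    intro hu
    obtain ⟨⟨b, hb⟩, hb'⟩ := isUnit_iff_exists_inv.1 hu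
    have hb'' : h * b = 1 := congrArg Subtype.val hb'
    have hb2 : b ∈ Algebra.adjoin k {h} := hb
    rw [Algebra.adjoin_singleton_eq_range_aeval] at hb2
    obtain ⟨q, rfl⟩ := hb2
    have : aeval h (X * q - 1) = 0 := by
      rw [map_sub, map_mul, aeval_X, map_one, sub_eq_zero]; exact hb''
    have h2 := (transcendental_iff.1 hh) _ this
    have h3 := congrArg (fun p => coeff p 0) h2
    simp at h3
  obtain ⟨B, hAB, hIB⟩ := Ideal.image_subset_nonunits_valuationSubring _ hI
  let w := B.valuation
  have hlt : w h < 1 := by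
    have : h ∈ B.nonunits := hIB ⟨hA, Ideal.subset_span rfl, rfl⟩
    exact this
  have hk1 : ∀ c : k, w (algebraMap k F c) ≤ 1 := fun c =>
    (B.valuation_le_one_iff _).2 (hAB ((Algebra.adjoin k {h}).algebraMap_mem c))
  have hk : ∀ c : k, c ≠ 0 → w (algebraMap k F c) = 1 := by
    intro c hc
    refine le_antisymm (hk1 c) ?_
    rw [w.one_le_val_iff (by simpa using hc), ← map_inv₀]
    exact hk1 _
  obtain ⟨N, hN, hpow⟩ := hF.exists_zpow_eq hh w hk hlt
  have hwh : 0 < w h := w.pos_iff.2 hh0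
  have hanti : StrictAnti (fun n : ℤ => w h ^ n) := zpow_right_strictAnti₀ hwh hlt
  choose! e he using hpow
  have e_unique : ∀ {u : F} {n : ℤ}, u ≠ 0 → w u ^ N = w h ^ n → e u = n := fun hu hn =>
    hanti.injective ((he _ hu).symm.trans hn)
  have hex : ∃ n : ℕ, 0 < n ∧ ∃ u : F, u ≠ 0 ∧ e u = n :=
    ⟨N, hN, h, hh0, e_unique hh0 (by simp)⟩
  classical
  -- The element π of least positive exponent is the uniformizer; division with remainder by that
  -- exponent will show that every value is a power of w(π).
  obtain ⟨hn0, π, hπ0, hπe⟩ := Nat.find_spec hex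
  set n := Nat.find hex
  have hmin : ∀ u : F, u ≠ 0 → 0 < e u → (n : ℤ) ≤ e u := by
    intro u hu hpos
    have := Nat.find_min' hex (m := (e u).toNat) ⟨by omega, u, hu, by omega⟩
    change n ≤ _ at this
    omega
  have e_pow : ∀ u v : F, ∀ q : ℤ, u ≠ 0 → v ≠ 0 → e (u * v ^ q) = e u + e v * q := by
    intro u v q hu hv
    refine e_unique (mul_ne_zero hu (zpow_ne_zero _ hv)) ?_
    rw [map_mul, map_zpow₀, mul_pow, he u hu, zpow_add₀ hwh.ne', zpow_mul, ← he v hv,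
      ← zpow_natCast (w v ^ q), ← zpow_natCast (w v), zpow_comm]
  have hval : ∀ u : F, u ≠ 0 → e u = 0 → w u = 1 := by
    intro u hu h0
    have := he u hu
    rw [h0, zpow_zero] at this
    exact (pow_eq_one_iff_of_nonneg zero_le hN.ne').1 this
  have hπ : w π < 1 := by
    rw [← pow_lt_one_iff_of_nonneg zero_le hN.ne', he π hπ0, hπe, zpow_natCast]
    exact pow_lt_one₀ hwh.le hlt hn0.ne'
  obtain ⟨v, hv, hvw⟩ := w.exists_normalized hπ0 hπ (fun u hu => by
    refine ⟨e u / n, ?_⟩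
    have h1 : e (u * π ^ (-(e u / n))) = e u % n := by
      rw [e_pow _ _ _ hu hπ0, hπe, Int.emod_def]; ring
    have hne : u * π ^ (-(e u / n)) ≠ 0 := mul_ne_zero hu (zpow_ne_zero _ hπ0)
    have hn0' : (0 : ℤ) < n := by exact_mod_cast hn0
    have h2 : e (u * π ^ (-(e u / n))) = 0 := by
      by_contra hcon
      have h3 := Int.emod_nonneg (e u) hn0'.ne'
      have h4 := Int.emod_lt_of_pos (e u) hn0'
      have := hmin _ hne (by omega)
      omega
    have h5 := hval _ hne h2
    rw [map_mul, map_zpow₀, zpow_neg] at h5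
    exact (mul_inv_eq_one₀ (zpow_ne_zero _ (w.ne_zero_iff.2 hπ0))).1 h5)
  have hv1 : ∀ a : F, v a ≤ 1 ↔ w a ≤ 1 := fun a => by
    rw [← map_one v, hvw, map_one]
  have hv1' : ∀ a : F, 1 ≤ v a ↔ 1 ≤ w a := fun a => by
    rw [← map_one v, hvw, map_one]
  refine ⟨⟨v, hv, fun c hc => le_antisymm ((hv1 _).2 (hk1 c)) ((hv1' _).2 (hk c hc).ge)⟩, ?_⟩
  exact lt_of_not_ge fun hcon => absurd ((hv1' h).1 hcon) (not_le.2 hlt)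

/-- A function without poles is constant. -/
theorem IsCurveFunctionField.constant_of_regular (hF : IsCurveFunctionField k F) {f : F}
    (hf : ∀ R : CurvePlace k F, R.v f ≤ 1) : f ∈ Set.range (algebraMap k F) := by
  by_contra hcon
  have ht := hF.transcendental hcon
  have ht' : Transcendental k f⁻¹ := fun h => ht (by simpa using h.inv)
  obtain ⟨R, hR⟩ := hF.exists_place_lt_one ht'
  have hf0 : f ≠ 0 := by rintro rfl; exact hcon ⟨0, map_zero _⟩
  exact absurd (hf R) (not_le.2 ((R.v.one_lt_val_iff hf0).2 hR))

end Places

/-! ### Comparison of places, and values at rational places -/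

namespace CurvePlace

variable {k F : Type*} [Field k] [Field F] [Algebra k F]

theorem v_eq_exp_neg_ord (R : CurvePlace k F) {f : F} (hf : f ≠ 0) :
    R.v f = WithZero.exp (-R.ord f) := by
  rw [ord, neg_neg, WithZero.exp_log (R.v.ne_zero_iff.2 hf)]

theorem ord_eq_neg_iff (R : CurvePlace k F) {f : F} (hf : f ≠ 0) (n : ℤ) :
    R.ord f = -n ↔ R.v f = WithZero.exp n := by
  rw [R.v_eq_exp_neg_ord hf, WithZero.exp_inj, neg_eq_iff_eq_neg]

theorem ext_v {R S : CurvePlace k F} (h : ∀ f, R.v f = S.v f) : R = S := by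
  cases R; cases S; congr; exact Valuation.ext h

/-- Otherwise the valuation ring of R lies in that of S, so units of R are units of S and S is
determined by its value at a uniformizer t of R. Surjectivity of S forces the order of t at S to be
±1, regularity of t excludes -1, and the two places agree. -/
theorem exists_v_le_one_lt {R S : CurvePlace k F} (hRS : R ≠ S) :
    ∃ u : F, R.v u ≤ 1 ∧ 1 < S.v u := by
  by_contra! hcon
  apply hRS
  obtain ⟨t, ht⟩ := R.surjective (WithZero.exp (-1))
  have ht0 : t ≠ 0 := R.v.ne_zero_iff.1 (by rw [ht]; exact WithZero.exp_ne_zero)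
  have hpow : ∀ f : F, f ≠ 0 → ∃ n : ℤ, R.v f = R.v t ^ n := fun f hf =>
    ⟨R.ord f, by rw [ht, R.v_eq_exp_neg_ord hf, ← WithZero.exp_zsmul]; simp⟩
  have hunit : ∀ f : F, R.v f = 1 → S.v f = 1 := fun f hf => by
    have hf0 : f ≠ 0 := by rintro rfl; simp at hf
    refine le_antisymm (hcon f hf.le) ((S.v.one_le_val_iff hf0).2 (hcon _ ?_))
    rw [map_inv₀, hf, inv_one]
  have hS : ∀ f : F, ∀ n : ℤ, f ≠ 0 → R.v f = R.v t ^ n → S.v f = S.v t ^ n := by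
    intro f n hf h
    have h1 := hunit (f / t ^ n) (by
      rw [map_div₀, map_zpow₀, h, div_self (zpow_ne_zero _ (R.v.ne_zero_iff.2 ht0))])
    rw [map_div₀, map_zpow₀] at h1
    exact (div_eq_one_iff_eq (zpow_ne_zero _ (S.v.ne_zero_iff.2 ht0))).1 h1
  have hSt : S.v t = WithZero.exp (-1) := by
    obtain ⟨f, hf⟩ := S.surjective (WithZero.exp (-1))
    have hf0 : f ≠ 0 := S.v.ne_zero_iff.1 (by rw [hf]; exact WithZero.exp_ne_zero)
    obtain ⟨n, hn⟩ := hpow f hf0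
    have h1 := hS f n hf0 hn
    have h2 : S.v t ≤ 1 := hcon t (by
      rw [ht, ← WithZero.exp_zero, WithZero.exp_le_exp]; norm_num)
    rw [S.v_eq_exp_neg_ord ht0, ← WithZero.exp_zero, WithZero.exp_le_exp] at h2
    rw [hf, S.v_eq_exp_neg_ord ht0, ← WithZero.exp_zsmul, WithZero.exp_inj, smul_eq_mul] at h1
    have h3 : n * S.ord t = 1 := by linarith
    rw [S.v_eq_exp_neg_ord ht0, WithZero.exp_inj]
    rcases Int.mul_eq_one_iff_eq_one_or_neg_one.1 h3 with h | h <;> omega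
  refine ext_v fun f => ?_
  by_cases hf : f = 0
  · simp [hf]
  · obtain ⟨n, hn⟩ := hpow f hf
    rw [hS f n hf hn, hn, hSt, ht]

theorem exists_v_lt_one_lt {R S : CurvePlace k F} (hRS : R ≠ S) :
    ∃ u : F, R.v u < 1 ∧ 1 < S.v u := by
  obtain ⟨a, ha, ha'⟩ := exists_v_le_one_lt hRS
  obtain ⟨b, hb, hb'⟩ := exists_v_le_one_lt hRS.symm
  have hR : R.v b ≠ 0 := (zero_lt_one.trans hb').ne'
  have hb0 : b ≠ 0 := R.v.ne_zero_iff.1 hR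
  have hS : 0 < S.v b := S.v.pos_iff.2 hb0
  refine ⟨a / b, ?_, ?_⟩
  · rw [map_div₀, div_lt_one₀ (zero_lt_one.trans hb')]
    exact ha.trans_lt hb'
  · rw [map_div₀, one_lt_div₀ hS]
    exact hb.trans_lt ha'

theorem value_eq (R : CurvePlace k F) {f : F} {c : k} (h : R.v (f - algebraMap k F c) < 1) :
    R.value f = c := by
  have hex : ∃ c : k, R.v (f - algebraMap k F c) < 1 := ⟨c, h⟩
  rw [value, dif_pos hex]
  have h1 := hex.choose_spec
  by_contra hne
  have h2 := R.trivial_on _ (sub_ne_zero.2 hne)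
  have h3 : algebraMap k F (hex.choose - c) =
      (f - algebraMap k F c) - (f - algebraMap k F hex.choose) := by
    rw [map_sub]; ring
  rw [h3] at h2
  exact (R.v.map_sub_lt h h1).ne h2

namespace IsRational

variable {R : CurvePlace k F} (hR : R.IsRational)
include hR

theorem v_sub_value {f : F} (hf : R.v f ≤ 1) : R.v (f - algebraMap k F (R.value f)) < 1 := by
  obtain ⟨c, hc⟩ := hR f hf
  rwa [R.value_eq hc]

theorem value_eq_zero_iff {f : F} (hf : R.v f ≤ 1) : R.value f = 0 ↔ R.v f < 1 := by
  constructor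
  · intro h
    have := hR.v_sub_value hf
    rwa [h, map_zero, sub_zero] at this
  · intro h
    exact R.value_eq (by simpa using h)

theorem value_add {f g : F} (hf : R.v f ≤ 1) (hg : R.v g ≤ 1) :
    R.value (f + g) = R.value f + R.value g := by
  refine R.value_eq ?_
  rw [map_add, add_sub_add_comm]
  exact R.v.map_add_lt (hR.v_sub_value hf) (hR.v_sub_value hg)

theorem value_mul {f g : F} (hf : R.v f ≤ 1) (hg : R.v g ≤ 1) :
    R.value (f * g) = R.value f * R.value g := by
  refine R.value_eq ?_
  have h : f * g - algebraMap k F (R.value f * R.value g) =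
      f * (g - algebraMap k F (R.value g)) +
        (f - algebraMap k F (R.value f)) * algebraMap k F (R.value g) := by
    rw [map_mul]; ring
  rw [h]
  refine R.v.map_add_lt ?_ ?_
  · rw [map_mul]
    exact (mul_le_of_le_one_left' hf).trans_lt (hR.v_sub_value hg)
  · rw [map_mul]
    exact (mul_le_of_le_one_right' (R.v_algebraMap_le_one _)).trans_lt (hR.v_sub_value hf)

omit hR in
theorem value_algebraMap (c : k) : R.value (algebraMap k F c) = c := R.value_eq (by simp)

/-- Two functions of the same order at a rational place have a constant ratio up to terms of
higher order. -/
theorem exists_v_sub_lt {f g : F} (hg : g ≠ 0) (h : R.v f ≤ R.v g) :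
    ∃ c : k, R.v (f - algebraMap k F c * g) < R.v g := by
  have hg' : 0 < R.v g := R.v.pos_iff.2 hg
  obtain ⟨c, hc⟩ := hR (f / g) (by rw [map_div₀]; exact div_le_one_of_le₀ h hg'.le)
  refine ⟨c, ?_⟩
  have h1 : f - algebraMap k F c * g = (f / g - algebraMap k F c) * g := by
    field_simp
  rw [h1, map_mul]
  exact mul_lt_of_lt_one_left hg' hc

end IsRational

end CurvePlace

/-! ### The ring L(∞Q) and pole orders at Q -/

section RingAtInfinity

variable {k F : Type*} [Field k] [Field F] [Algebra k F] {Q : CurvePlace k F}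

theorem mem_riemannRochSpace_mult {m : ℤ} {f : F} :
    f ∈ riemannRochSpace (multDivisor m Q) ↔
      Q.v f ≤ WithZero.exp m ∧ ∀ R : CurvePlace k F, R ≠ Q → R.v f ≤ 1 := by
  classical
  change (∀ R : CurvePlace k F, R.v f ≤ WithZero.exp (multDivisor m Q R)) ↔ _
  constructor
  · intro h
    refine ⟨by simpa [multDivisor] using h Q, fun R hR => ?_⟩
    simpa [multDivisor, Finsupp.single_apply, hR.symm] using h R
  · rintro ⟨h1, h2⟩ R
    by_cases hR : R = Q
    · subst hR; simpa [multDivisor] using h1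
    · simpa [multDivisor, Finsupp.single_apply, Ne.symm hR] using h2 R hR

theorem mem_ringAtInfinity_iff {f : F} :
    f ∈ ringAtInfinity Q ↔ ∀ R : CurvePlace k F, R ≠ Q → R.v f ≤ 1 := by
  constructor
  · rintro ⟨m, hm⟩
    exact (mem_riemannRochSpace_mult.1 hm).2
  · intro h
    refine ⟨(WithZero.log (Q.v f)).toNat, mem_riemannRochSpace_mult.2 ⟨?_, h⟩⟩
    exact WithZero.le_exp_of_log_le (Int.self_le_toNat _)

theorem mem_riemannRochSpace_mult_iff {m : ℤ} {f : F} :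
    f ∈ riemannRochSpace (multDivisor m Q) ↔ f ∈ ringAtInfinity Q ∧ Q.v f ≤ WithZero.exp m := by
  rw [mem_riemannRochSpace_mult, mem_ringAtInfinity_iff, and_comm]

theorem mem_weierstrassSemigroup_iff {m : ℕ} :
    m ∈ weierstrassSemigroup Q ↔ ∃ f ∈ ringAtInfinity Q, Q.v f = WithZero.exp (m : ℤ) := by
  constructor
  · rintro ⟨f, hf, hf0, h⟩
    exact ⟨f, hf, (Q.ord_eq_neg_iff hf0 _).1 h⟩
  · rintro ⟨f, hf, h⟩
    have hf0 : f ≠ 0 := by rintro rfl; rw [map_zero] at h; exact WithZero.exp_ne_zero h.symm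
    exact ⟨f, hf, hf0, (Q.ord_eq_neg_iff hf0 _).2 h⟩

theorem ringAtInfinity_eq_zero_of_lt_one (hF : IsCurveFunctionField k F) {f : F}
    (hf : f ∈ ringAtInfinity Q) (h : Q.v f < 1) : f = 0 := by
  rw [mem_ringAtInfinity_iff] at hf
  obtain ⟨c, rfl⟩ := hF.constant_of_regular (f := f) fun R => by
    by_cases hR : R = Q
    · rw [hR]; exact h.le
    · exact hf R hR
  by_contra hc
  rw [Q.trivial_on c (by rintro rfl; simp at hc)] at h
  exact lt_irrefl _ h

theorem exists_pole_order (hF : IsCurveFunctionField k F) {f : F}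
    (hf : f ∈ ringAtInfinity Q) (hf0 : f ≠ 0) : ∃ m : ℕ, Q.v f = WithZero.exp (m : ℤ) := by
  have h1 : 1 ≤ Q.v f := le_of_not_gt fun h => hf0 (ringAtInfinity_eq_zero_of_lt_one hF hf h)
  rw [Q.v_eq_exp_neg_ord hf0, ← WithZero.exp_zero, WithZero.exp_le_exp] at h1
  exact ⟨(-Q.ord f).toNat, by rw [Q.v_eq_exp_neg_ord hf0, Int.toNat_of_nonneg h1]⟩

end RingAtInfinity

/-- A pointed curve `Q` with distinct rational points `P₁, …, Pₗ ≠ Q` and a function `z` with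
divisor `P₁ + ⋯ + Pₗ - lQ`. -/
structure EvaluationSetup {k F : Type*} [Field k] [Field F] [Algebra k F] (Q : CurvePlace k F)
    {l : ℕ} (P : Fin l → CurvePlace k F) (z : F) : Prop where
  curve : IsCurveFunctionField k F
  rational : Q.IsRational
  rational_points : ∀ i, (P i).IsRational
  injective : Function.Injective P
  ne : ∀ i, P i ≠ Q
  divisor : HasDivisor z (pointsDivisor P - multDivisor (l : ℤ) Q)

/-! ### Evaluation on L(∞Q): its kernel and surjectivity -/

namespace EvaluationSetup

variable {k F : Type*} [Field k] [Field F] [Algebra k F] {Q : CurvePlace k F} {l : ℕ}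
  {P : Fin l → CurvePlace k F} {z : F} (S : EvaluationSetup Q P z)
include S

theorem z_ne_zero : z ≠ 0 := S.divisor.1

theorem v_z (R : CurvePlace k F) :
    R.v z = WithZero.exp (-(pointsDivisor P - multDivisor (l : ℤ) Q) R) := by
  rw [R.v_eq_exp_neg_ord S.z_ne_zero, S.divisor.2]

theorem v_z_infinity : Q.v z = WithZero.exp (l : ℤ) := by
  classical
  rw [S.v_z]
  simp [pointsDivisor, multDivisor, S.ne]

theorem v_z_point (i : Fin l) : (P i).v z = WithZero.exp (-1) := by
  classical
  rw [S.v_z]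
  simp [pointsDivisor, multDivisor, Finsupp.single_apply,
    (S.ne i).symm, S.injective.eq_iff]

theorem v_z_other {R : CurvePlace k F} (hQ : R ≠ Q) (hP : ∀ i, P i ≠ R) : R.v z = 1 := by
  classical
  rw [S.v_z]
  simp [pointsDivisor, multDivisor, hQ.symm, hP]

theorem v_z_point_lt_one (i : Fin l) : (P i).v z < 1 := by
  rw [S.v_z_point, ← WithZero.exp_zero, WithZero.exp_lt_exp]; norm_num

theorem z_mem : z ∈ ringAtInfinity Q := by
  rw [mem_ringAtInfinity_iff]
  intro R hR
  by_cases h : ∃ i, P i = R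
  · obtain ⟨i, rfl⟩ := h
    exact (S.v_z_point_lt_one i).le
  · exact (S.v_z_other hR (by simpa using h)).le

theorem v_point_le_one {f : F} (hf : f ∈ ringAtInfinity Q) (i : Fin l) : (P i).v f ≤ 1 :=
  mem_ringAtInfinity_iff.1 hf _ (S.ne i)

/-- The evaluation map on the functions that are regular outside `Q`. -/
def evalHom : ringAtInfinity Q →ₐ[k] (Fin l → k) where
  toFun f := evalAt P f
  map_one' := funext fun i => by
    have := CurvePlace.IsRational.value_algebraMap (R := P i) (1 : k)
    simpa [evalAt] using this
  map_zero' := funext fun i => by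
    have := CurvePlace.IsRational.value_algebraMap (R := P i) (0 : k)
    simpa [evalAt] using this
  map_mul' f g := funext fun i => (S.rational_points i).value_mul
    (S.v_point_le_one f.2 i) (S.v_point_le_one g.2 i)
  map_add' f g := funext fun i => (S.rational_points i).value_add
    (S.v_point_le_one f.2 i) (S.v_point_le_one g.2 i)
  commutes' c := funext fun i => CurvePlace.IsRational.value_algebraMap c

theorem evalHom_apply (f : ringAtInfinity Q) : S.evalHom f = evalAt P (f : F) := rfl

theorem evalHom_apply_eq_zero_iff (f : ringAtInfinity Q) (i : Fin l) :
    S.evalHom f i = 0 ↔ (P i).v (f : F) < 1 :=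
  (S.rational_points i).value_eq_zero_iff (S.v_point_le_one f.2 i)

/-- If f vanishes at all the points, f/z is regular outside Q, because outside Q the only zeros of z
are these points and they are simple. -/
theorem evalHom_eq_zero_iff (f : ringAtInfinity Q) :
    S.evalHom f = 0 ↔ ∃ g ∈ ringAtInfinity Q, (f : F) = z * g := by
  rw [funext_iff]
  simp only [Pi.zero_apply, S.evalHom_apply_eq_zero_iff]
  constructor
  · intro h
    refine ⟨(f : F) / z, ?_, (mul_div_cancel₀ _ S.z_ne_zero).symm⟩
    rw [mem_ringAtInfinity_iff]
    intro R hR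
    rw [map_div₀]
    by_cases hi : ∃ i, P i = R
    · obtain ⟨i, rfl⟩ := hi
      rw [S.v_z_point, div_le_one₀ WithZero.exp_pos]
      have h1 := h i
      by_cases hf0 : (f : F) = 0
      · rw [hf0, map_zero]; exact zero_le
      · rw [(P i).v_eq_exp_neg_ord hf0, ← WithZero.exp_zero, WithZero.exp_lt_exp] at h1
        rw [(P i).v_eq_exp_neg_ord hf0, WithZero.exp_le_exp]
        omega
    · rw [S.v_z_other hR (by simpa using hi), div_one]
      exact mem_ringAtInfinity_iff.1 f.2 R hR
  · rintro ⟨g, hg, h⟩ i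
    rw [h, map_mul]
    exact (mul_le_of_le_one_right' (S.v_point_le_one hg i)).trans_lt (S.v_z_point_lt_one i)

theorem transcendental_z (hl : l ≠ 0) : Transcendental k z := by
  refine S.curve.transcendental ?_
  rintro ⟨c, hc⟩
  have hc0 : c ≠ 0 := by rintro rfl; rw [map_zero] at hc; exact S.z_ne_zero hc.symm
  have h := S.v_z_infinity
  rw [← hc, Q.trivial_on c hc0, eq_comm, WithZero.exp_eq_one] at h
  exact hl (by exact_mod_cast h)

open Polynomial in
/-- The functions that are regular outside `Q` separate the points `P₁, …, Pₗ`. -/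
theorem exists_separating {i j : Fin l} (hij : i ≠ j) :
    ∃ f : ringAtInfinity Q, S.evalHom f i = 0 ∧ S.evalHom f j ≠ 0 := by
  by_contra! hcon
  obtain ⟨u, hui, huj⟩ := CurvePlace.exists_v_lt_one_lt (S.injective.ne hij)
  -- Subtracting the constant f(P i) reverses the assumed implication: vanishing at P j also forces
  -- vanishing at P i.
  have hlt : ∀ f ∈ ringAtInfinity Q, (P j).v f < 1 → (P i).v f < 1 := by
    intro f hf hfj
    let f' : ringAtInfinity Q := ⟨f, hf⟩
    let c := S.evalHom f' i
    have h1 := hcon (f' - algebraMap k _ c) (by simp [c])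
    have h2 : S.evalHom f' j = 0 := (S.evalHom_apply_eq_zero_iff f' j).2 hfj
    have h3 : c = 0 := by simpa [h2] using h1
    exact (S.evalHom_apply_eq_zero_iff f' i).1 h3
  have hl : l ≠ 0 := by rintro rfl; exact i.elim0
  -- The function u distinguishes the two points but may have poles elsewhere. The Horner tails b m
  -- of its equation over k[z] replace it by functions in L(∞Q).
  obtain ⟨n, a, hsum, j₀, hj₀, ha⟩ := S.curve.exists_relation (S.transcendental_z hl) u
  let b : ℕ → F := fun m => ∑ t ∈ Finset.range (n - m), aeval z (a (m + t)) * u ^ t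
  have hb : ∀ m < n, b m = aeval z (a m) + b (m + 1) * u := by
    intro m hm
    simp only [b]
    rw [show n - m = n - (m + 1) + 1 by omega, Finset.sum_range_succ', Finset.sum_mul, add_comm]
    congr 1
    · simp
    · exact Finset.sum_congr rfl fun t _ => by rw [add_right_comm, add_assoc m, pow_succ]; ring
  have hpartial : ∀ m ≤ n, ∑ t ∈ Finset.range m, aeval z (a t) * u ^ t + b m * u ^ m = 0 := by
    intro m
    induction m with
    | zero => intro _; simpa [b] using hsum
    | succ m ih =>
      intro hm
      rw [← ih (by omega), Finset.sum_range_succ, hb m (by omega)]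
      ring
  have hk : ∀ (R : CurvePlace k F) (t : ℕ), R ≠ Q → R.v (aeval z (a t)) ≤ 1 := fun R t hR =>
    R.v.map_aeval_le_one R.v_algebraMap_le_one (mem_ringAtInfinity_iff.1 S.z_mem R hR) _
  -- Where u is regular this is clear. At a pole of u, `hpartial` writes b m * u^m through the
  -- powers of u below m, which bounds b m * u, hence also b m.
  have hbmem : ∀ m ≤ n, ∀ R : CurvePlace k F, R ≠ Q → R.v (b m) ≤ 1 ∧ R.v (b m * u) ≤ 1 := by
    intro m hm R hR
    rcases le_or_gt (R.v u) 1 with hu | hu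
    · have h1 : R.v (b m) ≤ 1 := by
        refine R.v.map_sum_le fun t _ => ?_
        rw [map_mul, map_pow]
        exact mul_le_one' (hk R _ hR) (pow_le_one' hu _)
      exact ⟨h1, by rw [map_mul]; exact mul_le_one' h1 hu⟩
    · have h2 : R.v (b m * u) ≤ 1 := by
        cases m with
        | zero =>
          have : b 0 = 0 := by simpa using hpartial 0 (Nat.zero_le _)
          simp [this]
        | succ m =>
          have h3 : R.v (b (m + 1) * u ^ (m + 1)) ≤ R.v u ^ m := by
            rw [← neg_eq_of_add_eq_zero_right (hpartial _ hm), R.v.map_neg]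
            refine R.v.map_sum_le fun t ht => ?_
            rw [map_mul, map_pow]
            calc _ ≤ 1 * R.v u ^ t := mul_le_mul_left (hk R _ hR) _
              _ = R.v u ^ t := one_mul _
              _ ≤ R.v u ^ m :=
                pow_le_pow_right₀ hu.le (Nat.lt_succ_iff.1 (Finset.mem_range.1 ht))
          have hpos : 0 < R.v u ^ m := pow_pos (zero_lt_one.trans hu) _
          rw [pow_succ', ← mul_assoc, map_mul _ _ (u ^ m), map_pow] at h3
          exact (mul_le_iff_le_one_left hpos).1 h3
      refine ⟨?_, h2⟩
      rw [map_mul] at h2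
      calc R.v (b m) = R.v (b m) * 1 := (mul_one _).symm
        _ ≤ R.v (b m) * R.v u := mul_le_mul_right hu.le _
        _ ≤ 1 := h2
  -- Since z vanishes at P i and a j₀ has nonzero constant term, b j₀ - b (j₀ + 1) * u is a unit
  -- there. The second term vanishes at P i, so b j₀ does not; then b j₀ is a unit at P j too, and b
  -- j₀ * u has a pole there, contrary to `hbmem`.
  have hα : (P i).v (aeval z (a j₀)) = 1 :=
    (P i).v.map_aeval_eq_one (P i).trivial_on (S.v_z_point_lt_one i) ha
  rw [← sub_eq_of_eq_add (hb j₀ hj₀)] at hα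
  have h1 : (P i).v (b (j₀ + 1) * u) < 1 := by
    rw [map_mul]
    exact (mul_le_of_le_one_left' (hbmem _ hj₀ _ (S.ne i)).1).trans_lt hui
  have h2 : (P i).v (b j₀) = 1 := by
    by_contra hne
    have h3 := lt_of_le_of_ne (hbmem _ hj₀.le _ (S.ne i)).1 hne
    exact ((P i).v.map_sub_lt h3 h1).ne hα
  have h3 : (P j).v (b j₀) = 1 := by
    refine le_antisymm (hbmem _ hj₀.le _ (S.ne j)).1 (le_of_not_gt fun h => ?_)
    refine (hlt (b j₀) (mem_ringAtInfinity_iff.2 fun R hR => (hbmem _ hj₀.le R hR).1) h).ne h2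
  have h4 := (hbmem _ hj₀.le _ (S.ne j)).2
  rw [map_mul, h3, one_mul] at h4
  exact absurd huj (not_lt.2 h4)

/-- Products of separating functions, rescaled, give the standard basis vectors, as in Lagrange
interpolation. -/
theorem evalHom_surjective : Function.Surjective S.evalHom := by
  classical
  have hsep : ∀ i j : Fin l, ∃ f : ringAtInfinity Q,
      i ≠ j → S.evalHom f i = 0 ∧ S.evalHom f j ≠ 0 := fun i j => by
    by_cases h : i = j
    · exact ⟨0, fun h' => absurd h h'⟩
    · obtain ⟨f, hf⟩ := S.exists_separating h
      exact ⟨f, fun _ => hf⟩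
  choose f hf using hsep
  have hsingle : ∀ i : Fin l, ∃ g : ringAtInfinity Q, S.evalHom g = Pi.single i 1 := by
    intro i
    let p : ringAtInfinity Q := ∏ j ∈ Finset.univ.erase i, f j i
    have hp : ∀ t, S.evalHom p t = ∏ j ∈ Finset.univ.erase i, S.evalHom (f j i) t := fun t => by
      simp [p, map_prod]
    have hpi : S.evalHom p i ≠ 0 := by
      rw [hp]
      exact Finset.prod_ne_zero_iff.2 fun j hj => (hf j i (Finset.ne_of_mem_erase hj)).2
    refine ⟨algebraMap k _ (S.evalHom p i)⁻¹ * p, funext fun t => ?_⟩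
    rw [map_mul, AlgHom.commutes]
    by_cases ht : t = i
    · subst ht
      simp [hpi]
    · have : S.evalHom p t = 0 := by
        rw [hp]
        exact Finset.prod_eq_zero (Finset.mem_erase.2 ⟨ht, Finset.mem_univ t⟩) (hf t i ht).1
      simp [this, ht]
  choose g hg using hsingle
  intro c
  refine ⟨∑ i, c i • g i, ?_⟩
  rw [map_sum]
  ext t
  simp [hg, Finset.sum_apply, Pi.single_apply]

end EvaluationSetup

theorem WithZero.lt_exp_add_one_iff {x : ℤᵐ⁰} {n : ℤ} :
    x < WithZero.exp (n + 1) ↔ x ≤ WithZero.exp n := by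
  rw [WithZero.exp_add, WithZero.lt_mul_exp_iff_le WithZero.exp_ne_zero]

/-! ### H*(Q) as an Apéry set, and kernels through pole orders -/

namespace EvaluationSetup

variable {k F : Type*} [Field k] [Field F] [Algebra k F] {Q : CurvePlace k F} {l : ℕ}
  {P : Fin l → CurvePlace k F} {z : F} (S : EvaluationSetup Q P z)
include S

/-- A function with zero evaluation is zg with g in L(∞Q), and its pole order is then l more than
that of g. -/
theorem evalHom_ne_zero_of_forall_ne {m : ℕ} (hm : ∀ n ∈ weierstrassSemigroup Q, m ≠ n + l)
    {f : ringAtInfinity Q} (hf : Q.v (f : F) = WithZero.exp (m : ℤ)) : S.evalHom f ≠ 0 := by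
  intro h
  obtain ⟨g, hg, hfg⟩ := (S.evalHom_eq_zero_iff f).1 h
  have hg0 : g ≠ 0 := by
    rintro rfl
    rw [hfg, mul_zero, map_zero] at hf
    exact WithZero.exp_ne_zero hf.symm
  obtain ⟨n, hn⟩ := exists_pole_order S.curve hg hg0
  refine hm n (mem_weierstrassSemigroup_iff.2 ⟨g, hg, hn⟩) ?_
  rw [hfg, map_mul, S.v_z_infinity, hn, ← WithZero.exp_add, WithZero.exp_inj] at hf
  omega

/-- The set `H*(Q)` is the Apéry set of `H(Q)` with respect to `l`. -/
theorem mem_hStar_iff {m : ℕ} :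
    m ∈ hStar P Q ↔ m ∈ weierstrassSemigroup Q ∧ ∀ n ∈ weierstrassSemigroup Q, m ≠ n + l := by
  have hsub : evalCode P (multDivisor ((m : ℤ) - 1) Q) ⊆ evalCode P (multDivisor (m : ℤ) Q) := by
    refine Set.image_mono fun f hf => ?_
    have hf := mem_riemannRochSpace_mult_iff.1 hf
    exact mem_riemannRochSpace_mult_iff.2
      ⟨hf.1, hf.2.trans (WithZero.exp_le_exp.2 (by omega))⟩
  have hiff : m ∈ hStar P Q ↔
      ¬ evalCode P (multDivisor (m : ℤ) Q) ⊆ evalCode P (multDivisor ((m : ℤ) - 1) Q) := by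
    change _ ≠ _ ↔ _
    rw [Ne, subset_antisymm_iff, not_and]
    exact ⟨fun h => h hsub, fun h _ => h⟩
  have hlow : ∀ f ∈ ringAtInfinity Q, Q.v f < WithZero.exp (m : ℤ) →
      f ∈ riemannRochSpace (multDivisor ((m : ℤ) - 1) Q) := fun f hf hlt =>
    mem_riemannRochSpace_mult_iff.2 ⟨hf, WithZero.lt_exp_add_one_iff.1 (by simpa using hlt)⟩
  rw [hiff]
  constructor
  · intro h
    obtain ⟨_, ⟨f, hf, rfl⟩, hnot⟩ := Set.not_subset.1 h
    obtain ⟨hfA, hfv⟩ := mem_riemannRochSpace_mult_iff.1 hf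
    have hfm : Q.v f = WithZero.exp (m : ℤ) := by
      by_contra hne
      exact hnot ⟨f, hlow f hfA (lt_of_le_of_ne hfv hne), rfl⟩
    refine ⟨mem_weierstrassSemigroup_iff.2 ⟨f, hfA, hfm⟩, fun n hn hmn => hnot ?_⟩
    obtain ⟨g, hg, hgn⟩ := mem_weierstrassSemigroup_iff.1 hn
    have hzg : Q.v (z * g) = WithZero.exp (m : ℤ) := by
      rw [map_mul, S.v_z_infinity, hgn, ← WithZero.exp_add, WithZero.exp_inj]; omega
    have hzg0 : z * g ≠ 0 := Q.v.ne_zero_iff.1 (by rw [hzg]; exact WithZero.exp_ne_zero)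
    -- Subtracting a multiple of zg lowers the pole order below m and leaves the evaluation
    -- unchanged.
    obtain ⟨c, hc⟩ := S.rational.exists_v_sub_lt hzg0 (hfm.trans hzg.symm).le
    let zg : ringAtInfinity Q := ⟨z * g, mul_mem S.z_mem hg⟩
    have h0 : S.evalHom zg = 0 := (S.evalHom_eq_zero_iff zg).2 ⟨g, hg, rfl⟩
    let d : ringAtInfinity Q := ⟨f, hfA⟩ - algebraMap k _ c * zg
    refine ⟨d, hlow d d.2 (hc.trans_eq hzg), ?_⟩
    have h1 : S.evalHom d = S.evalHom ⟨f, hfA⟩ := by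
      simp only [d, map_sub, map_mul, h0, mul_zero, sub_zero]
    exact h1
  · rintro ⟨hm, hl⟩ hcon
    obtain ⟨f, hf, hfm⟩ := mem_weierstrassSemigroup_iff.1 hm
    obtain ⟨g, hg, hgf⟩ := hcon ⟨f, mem_riemannRochSpace_mult_iff.2 ⟨hf, hfm.le⟩, rfl⟩
    obtain ⟨hgA, hgv⟩ := mem_riemannRochSpace_mult_iff.1 hg
    let d : ringAtInfinity Q := ⟨f, hf⟩ - ⟨g, hgA⟩
    have hd : Q.v (d : F) = WithZero.exp (m : ℤ) := by
      refine (Q.v.map_sub_eq_of_lt_left ?_).trans hfm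
      rw [hfm]
      exact hgv.trans_lt (WithZero.exp_lt_exp.2 (by omega))
    refine S.evalHom_ne_zero_of_forall_ne hl hd ?_
    rw [map_sub, sub_eq_zero]
    exact hgf.symm

theorem evalHom_ne_zero {m : ℕ} (hm : m ∈ hStar P Q) {f : ringAtInfinity Q}
    (hf : Q.v (f : F) = WithZero.exp (m : ℤ)) : S.evalHom f ≠ 0 :=
  S.evalHom_ne_zero_of_forall_ne (S.mem_hStar_iff.1 hm).2 hf

theorem exists_of_mem_hStar {m : ℕ} (hm : m ∈ hStar P Q) :
    ∃ f : ringAtInfinity Q, Q.v (f : F) = WithZero.exp (m : ℤ) := by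
  obtain ⟨f, hf, h⟩ := mem_weierstrassSemigroup_iff.1 (S.mem_hStar_iff.1 hm).1
  exact ⟨⟨f, hf⟩, h⟩

/-- Functions whose pole orders are distinct elements of `H*(Q)` have linearly independent
evaluations. -/
theorem linearIndependent_evalHom {ι : Type*} {m : ι → ℕ} (hm : Function.Injective m)
    (hmem : ∀ i, m i ∈ hStar P Q) {f : ι → ringAtInfinity Q}
    (hf : ∀ i, Q.v (f i : F) = WithZero.exp (m i : ℤ)) :
    LinearIndependent k fun i => S.evalHom (f i) := by
  classical
  rw [linearIndependent_iff']
  intro s c hsum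
  by_contra! hcon
  obtain ⟨i₀, hi₀, hc₀⟩ := hcon
  obtain ⟨i, hi, hmax⟩ := (s.filter fun i => c i ≠ 0).exists_max_image m
    ⟨i₀, Finset.mem_filter.2 ⟨hi₀, hc₀⟩⟩
  obtain ⟨his, hci⟩ := Finset.mem_filter.1 hi
  have hv : ∀ j, c j ≠ 0 → Q.v ((c j • f j : ringAtInfinity Q) : F) = WithZero.exp (m j : ℤ) := by
    intro j hj
    change Q.v (c j • (f j : F)) = _
    rw [Algebra.smul_def, map_mul, Q.trivial_on _ hj, one_mul, hf]
  have hvsum : Q.v ((∑ j ∈ s, c j • f j : ringAtInfinity Q) : F) = WithZero.exp (m i : ℤ) := by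
    rw [← hv i hci, AddSubmonoidClass.coe_finsetSum]
    refine Q.v.map_sum_eq_of_lt his fun j hj => ?_
    rw [Finset.mem_sdiff, Finset.mem_singleton] at hj
    rw [hv i hci]
    by_cases hcj : c j = 0
    · simp [hcj]
    · rw [hv j hcj, WithZero.exp_lt_exp]
      have := lt_of_le_of_ne (hmax j (Finset.mem_filter.2 ⟨hj.1, hcj⟩)) (hm.ne hj.2)
      exact_mod_cast this
  refine S.evalHom_ne_zero (hmem i) hvsum ?_
  rw [map_sum, ← hsum]
  simp only [map_smul]

/-- Leading terms are removed one pole order at a time. At an order outside H*(Q) the subtracted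
function is a multiple of z, which contributes nothing to the evaluation; so only the orders in
H*(Q) are needed. -/
theorem evalHom_mem_span {g : ℕ → ringAtInfinity Q}
    (hg : ∀ m ∈ hStar P Q, Q.v (g m : F) = WithZero.exp (m : ℤ)) (n : ℕ) (f : ringAtInfinity Q)
    (hf : Q.v (f : F) < WithZero.exp (n : ℤ)) :
    S.evalHom f ∈ Submodule.span k ((fun m => S.evalHom (g m)) '' {m ∈ hStar P Q | m < n}) := by
  induction n generalizing f with
  | zero =>
    have : f = 0 := Subtype.ext (ringAtInfinity_eq_zero_of_lt_one S.curve f.2 (by simpa using hf))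
    rw [this, map_zero]
    exact Submodule.zero_mem _
  | succ n ih =>
    have hmono : {m ∈ hStar P Q | m < n} ⊆ {m ∈ hStar P Q | m < n + 1} :=
      fun m hm => ⟨hm.1, hm.2.trans n.lt_succ_self⟩
    have ih' := fun f hf => Submodule.span_mono (Set.image_mono hmono) (ih f hf)
    have hle : Q.v (f : F) ≤ WithZero.exp (n : ℤ) :=
      WithZero.lt_exp_add_one_iff.1 (by exact_mod_cast hf)
    have hstep : ∀ h : ringAtInfinity Q, Q.v (h : F) = WithZero.exp (n : ℤ) →
        S.evalHom h ∈ Submodule.span k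
          ((fun m => S.evalHom (g m)) '' {m ∈ hStar P Q | m < n + 1}) →
        S.evalHom f ∈ Submodule.span k
          ((fun m => S.evalHom (g m)) '' {m ∈ hStar P Q | m < n + 1}) := by
      intro h hh hspan
      have hh0 : (h : F) ≠ 0 := Q.v.ne_zero_iff.1 (by rw [hh]; exact WithZero.exp_ne_zero)
      obtain ⟨c, hc⟩ := S.rational.exists_v_sub_lt hh0 (hle.trans hh.ge)
      have h1 := ih' (f - algebraMap k _ c * h) (hc.trans_eq hh)
      have h2 := Submodule.add_mem _ h1 (Submodule.smul_mem _ c hspan)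
      rwa [map_sub, ← Algebra.smul_def, map_smul, sub_add_cancel] at h2
    by_cases hn : n ∈ hStar P Q
    · exact hstep (g n) (hg n hn) (Submodule.subset_span ⟨n, ⟨hn, n.lt_succ_self⟩, rfl⟩)
    by_cases hfn : Q.v (f : F) = WithZero.exp (n : ℤ)
    · have hnH : n ∈ weierstrassSemigroup Q := mem_weierstrassSemigroup_iff.2 ⟨f, f.2, hfn⟩
      rw [S.mem_hStar_iff, not_and] at hn
      have := hn hnH
      push Not at this
      obtain ⟨t, ht, hnt⟩ := this
      obtain ⟨h, hh, hht⟩ := mem_weierstrassSemigroup_iff.1 ht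
      let zh : ringAtInfinity Q := ⟨z * h, mul_mem S.z_mem hh⟩
      refine hstep zh ?_ ?_
      · change Q.v (z * h) = _
        rw [map_mul, S.v_z_infinity, hht, ← WithZero.exp_add, WithZero.exp_inj]; omega
      · rw [(S.evalHom_eq_zero_iff zh).2 ⟨h, hh, rfl⟩]
        exact Submodule.zero_mem _
    · exact ih' f (lt_of_le_of_ne hle hfn)

theorem exists_poleFunctions :
    ∃ g : ℕ → ringAtInfinity Q, ∀ m ∈ hStar P Q, Q.v (g m : F) = WithZero.exp (m : ℤ) := by
  have h : ∀ m : ℕ, ∃ f : ringAtInfinity Q,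
      m ∈ hStar P Q → Q.v (f : F) = WithZero.exp (m : ℤ) := fun m => by
    by_cases hm : m ∈ hStar P Q
    · obtain ⟨f, hf⟩ := S.exists_of_mem_hStar hm
      exact ⟨f, fun _ => hf⟩
    · exact ⟨0, fun h => absurd h hm⟩
  choose g hg using h
  exact ⟨g, hg⟩

/-- The set `H*(Q)` has `l` elements `m₁ < ⋯ < mₗ`. -/
theorem exists_enumeration : ∃ m : Fin l → ℕ, StrictMono m ∧ Set.range m = hStar P Q := by
  obtain ⟨g, hg⟩ := S.exists_poleFunctions
  have hli := S.linearIndependent_evalHom (ι := hStar P Q) (m := Subtype.val)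
    Subtype.val_injective Subtype.prop (f := fun m => g m) fun m => hg m m.2
  have hspan : ⊤ ≤ Submodule.span k (Set.range fun m : hStar P Q => S.evalHom (g m)) := by
    rintro c -
    obtain ⟨f, rfl⟩ := S.evalHom_surjective c
    have hlt : Q.v (f : F) < WithZero.exp (((WithZero.log (Q.v (f : F))).toNat + 1 : ℕ) : ℤ) := by
      rw [Nat.cast_add, Nat.cast_one, WithZero.lt_exp_add_one_iff]
      exact WithZero.le_exp_of_log_le (Int.self_le_toNat _)
    refine Submodule.span_mono ?_ (S.evalHom_mem_span hg _ f hlt)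
    rintro _ ⟨m, hm, rfl⟩
    exact ⟨⟨m, hm.1⟩, rfl⟩
  let b := Module.Basis.mk hli hspan
  have : Finite (hStar P Q) := Module.Finite.finite_basis b
  have hcard : (hStar P Q).ncard = l := by
    have := Module.finrank_eq_nat_card_basis b
    rw [Module.finrank_fin_fun] at this
    exact this.symm
  have hfin : (hStar P Q).Finite := Set.toFinite _
  have hcard' : hfin.toFinset.card = l := by rw [← Set.ncard_eq_toFinset_card _ hfin, hcard]
  refine ⟨hfin.toFinset.orderEmbOfFin hcard', OrderEmbedding.strictMono _, ?_⟩
  rw [Finset.range_orderEmbOfFin]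
  simp

theorem isKernel_of_pole_orders {m : Fin l → ℕ} (hm : StrictMono m)
    (hrange : Set.range m = hStar P Q) {f : Fin l → ringAtInfinity Q}
    (hf : ∀ i, Q.v (f i : F) = WithZero.exp (m i : ℤ)) {G : Matrix (Fin l) (Fin l) k}
    (hG : ∀ i, G i = S.evalHom (f i)) : IsKernel P Q G := by
  refine ⟨m, fun i => f i, hm, hrange, fun i => ?_, fun i j hij hcon => ?_, hG, ?_⟩
  · exact mem_riemannRochSpace_mult_iff.2 ⟨(f i).2, (hf i).le⟩
  · have := (mem_riemannRochSpace_mult_iff.1 hcon).2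
    rw [hf, WithZero.exp_le_exp] at this
    have h2 := hm hij
    omega
  · have := S.linearIndependent_evalHom hm.injective (fun i => hrange ▸ Set.mem_range_self i) hf
    simpa only [hG] using this

/-- The definition of a kernel only bounds the pole order of the i-th function by m i; linear
independence of the rows forces equality. -/
theorem exists_pole_orders_of_isKernel {m : Fin l → ℕ} (hm : StrictMono m)
    (hrange : Set.range m = hStar P Q) {G : Matrix (Fin l) (Fin l) k} (hG : IsKernel P Q G) :
    ∃ f : Fin l → ringAtInfinity Q, (∀ i, Q.v (f i : F) = WithZero.exp (m i : ℤ)) ∧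
      ∀ i, G i = S.evalHom (f i) := by
  classical
  obtain ⟨m', f, hm', hrange', hf, -, hGf, hli⟩ := hG
  obtain rfl : m' = m := (hm'.range_inj hm).1 (hrange'.trans hrange.symm)
  have hf' := fun i => mem_riemannRochSpace_mult_iff.1 (hf i)
  refine ⟨fun i => ⟨f i, (hf' i).1⟩, fun i => ?_, hGf⟩
  refine le_antisymm (hf' i).2 (le_of_not_gt fun hlt => ?_)
  change Q.v (f i) < _ at hlt
  obtain ⟨g, hg⟩ := S.exists_poleFunctions
  -- If the i-th pole order were smaller than m i, the i + 1 rows with indices 0, …, i would all lie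
  -- in this span of i vectors.
  let W := Submodule.span k (Set.range fun t : Finset.Iio i => S.evalHom (g (m' t)))
  have hW : ∀ j : Finset.Iic i, G j ∈ W := by
    rintro ⟨j, hj⟩
    rw [Finset.mem_Iic] at hj
    have hjlt : Q.v (f j) < WithZero.exp (m' i : ℤ) := by
      rcases hj.lt_or_eq with h | rfl
      · refine (hf' j).2.trans_lt (WithZero.exp_lt_exp.2 ?_)
        exact_mod_cast hm' h
      · exact hlt
    have h1 := S.evalHom_mem_span hg (m' i) ⟨f j, (hf' j).1⟩ hjlt
    change G j ∈ W
    rw [hGf]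
    refine Submodule.span_mono ?_ h1
    rintro _ ⟨n, ⟨hn, hni⟩, rfl⟩
    rw [← hrange'] at hn
    obtain ⟨t, rfl⟩ := hn
    exact ⟨⟨t, Finset.mem_Iio.2 (hm'.lt_iff_lt.1 hni)⟩, rfl⟩
  have hli' : LinearIndependent k fun j : Finset.Iic i => G j :=
    hli.comp _ Subtype.val_injective
  have h1 := finrank_span_eq_card hli'
  have h2 : Submodule.span k (Set.range fun j : Finset.Iic i => G j) ≤ W :=
    Submodule.span_le.2 (by rintro _ ⟨j, rfl⟩; exact hW j)
  have h3 := Submodule.finrank_mono h2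
  have h4 : Module.finrank k W ≤ Fintype.card (Finset.Iio i) := finrank_range_le_card _
  rw [h1] at h3
  simp only [Fintype.card_coe, Fin.card_Iic, Fin.card_Iio] at h3 h4
  omega

/-! ### Passing from D to D' -/

section Puncturing

variable {s : ℕ} {κ : Fin s → Fin l} {z' : F} (S' : EvaluationSetup Q (P ∘ κ) z')
include S'

theorem exists_eq_mul : ∃ y ∈ ringAtInfinity Q, z = z' * y :=
  (S'.evalHom_eq_zero_iff ⟨z, S.z_mem⟩).1 <| funext fun t =>
    (S'.evalHom_apply_eq_zero_iff ⟨z, S.z_mem⟩ t).2 (S.v_z_point_lt_one (κ t))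

/-- If m = n + l with n in H(Q), some zg has pole order m. It is also a multiple of z', so it
vanishes on D', which is impossible for m in H* of D'. -/
theorem hStar_comp_subset : hStar (P ∘ κ) Q ⊆ hStar P Q := by
  intro m hm
  rw [S'.mem_hStar_iff] at hm
  rw [S.mem_hStar_iff]
  refine ⟨hm.1, fun n hn hmn => ?_⟩
  obtain ⟨y, hy, hzy⟩ := S.exists_eq_mul S'
  obtain ⟨g, hg, hgn⟩ := mem_weierstrassSemigroup_iff.1 hn
  have hv : Q.v (z * g) = WithZero.exp (m : ℤ) := by
    rw [map_mul, S.v_z_infinity, hgn, ← WithZero.exp_add, WithZero.exp_inj]; omega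
  let f : ringAtInfinity Q := ⟨z * g, mul_mem S.z_mem hg⟩
  refine S'.evalHom_ne_zero_of_forall_ne hm.2 (f := f) hv ?_
  exact (S'.evalHom_eq_zero_iff f).2 ⟨y * g, mul_mem hy hg, by rw [← mul_assoc, ← hzy]⟩

theorem exists_rows {m : Fin l → ℕ} (hm : StrictMono m) (hrange : Set.range m = hStar P Q)
    {m' : Fin s → ℕ} (hm' : StrictMono m') (hrange' : Set.range m' = hStar (P ∘ κ) Q) :
    ∃ rows : Fin s ↪o Fin l, ∀ t, m (rows t) = m' t := by
  have h : ∀ t, ∃ i, m i = m' t := fun t => by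
    have : m' t ∈ Set.range m :=
      hrange ▸ S.hStar_comp_subset S' (hrange' ▸ Set.mem_range_self t)
    exact this
  choose ρ hρ using h
  have hmono : StrictMono ρ := fun t u htu => hm.lt_iff_lt.1 (by rw [hρ, hρ]; exact hm' htu)
  exact ⟨OrderEmbedding.ofStrictMono ρ hmono, hρ⟩

variable {m : Fin l → ℕ} (hm : StrictMono m) (hrange : Set.range m = hStar P Q)
  {m' : Fin s → ℕ} (hm' : StrictMono m') (hrange' : Set.range m' = hStar (P ∘ κ) Q)
  {rows : Fin s ↪o Fin l} (hrows : ∀ t, m (rows t) = m' t)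
include hm hrange hm' hrange' hrows

theorem isKernel_submatrix {G : Matrix (Fin l) (Fin l) k} (hG : IsKernel P Q G) :
    IsKernel (P ∘ κ) Q (G.submatrix rows κ) := by
  obtain ⟨f, hf, hGf⟩ := S.exists_pole_orders_of_isKernel hm hrange hG
  refine S'.isKernel_of_pole_orders hm' hrange' (f := fun t => f (rows t))
    (fun t => by rw [hf, hrows]) fun t => ?_
  funext u
  change G (rows t) (κ u) = _
  rw [hGf]
  rfl

theorem exists_isKernel_submatrix {G' : Matrix (Fin s) (Fin s) k} (hG' : IsKernel (P ∘ κ) Q G') :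
    ∃ G : Matrix (Fin l) (Fin l) k, IsKernel P Q G ∧ G' = G.submatrix rows κ := by
  obtain ⟨f', hf', hGf'⟩ := S'.exists_pole_orders_of_isKernel hm' hrange' hG'
  -- The functions of G' are kept in the chosen rows; any function of the right pole order fills
  -- each other row.
  have h : ∀ i, ∃ f : ringAtInfinity Q, Q.v (f : F) = WithZero.exp (m i : ℤ) ∧
      ∀ t, rows t = i → f = f' t := by
    intro i
    by_cases hi : ∃ t, rows t = i
    · obtain ⟨t, rfl⟩ := hi
      refine ⟨f' t, by rw [hf', hrows], fun u hu => ?_⟩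
      rw [rows.injective hu]
    · obtain ⟨f, hf⟩ := S.exists_of_mem_hStar (hrange ▸ Set.mem_range_self i)
      exact ⟨f, hf, fun t ht => absurd ⟨t, ht⟩ hi⟩
  choose f hf hff' using h
  refine ⟨fun i => S.evalHom (f i), S.isKernel_of_pole_orders hm hrange hf fun i => rfl, ?_⟩
  ext t u
  change G' t u = S.evalHom (f (rows t)) (κ u)
  rw [hff' _ t rfl, hGf']
  rfl

end Puncturing

end EvaluationSetup

/-! ### Polynomials representing functions in L(∞Q), and weights -/

section Generators

open MvPolynomial

variable {k F : Type*} [Field k] [Field F] [Algebra k F] {Q : CurvePlace k F}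
  {r : ℕ} {a : Fin r → ℕ} {x : Fin r → F}

/-- The map `k[t₁, …, tᵣ] → L(∞Q)` that sends `tⱼ` to `xⱼ ∈ L(∞Q)`. -/
def polyHom (hx : ∀ j, x j ∈ ringAtInfinity Q) :
    MvPolynomial (Fin r) k →ₐ[k] ringAtInfinity Q :=
  aeval fun j => ⟨x j, hx j⟩

theorem coe_polyHom (hx : ∀ j, x j ∈ ringAtInfinity Q) (p : MvPolynomial (Fin r) k) :
    (polyHom hx p : F) = aeval x p := by
  change (ringAtInfinity Q).val (polyHom hx p) = _
  rw [polyHom, comp_aeval_apply]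
  rfl

theorem exists_monomialWeight_eq {n : ℕ} (hn : n ∈ AddSubmonoid.closure (Set.range a)) :
    ∃ u : Fin r →₀ ℕ, monomialWeight a u = n := by
  obtain ⟨u, hu⟩ := AddSubmonoid.mem_closure_range_iff.1 hn
  exact ⟨u, by
    rw [hu, monomialWeight, Finsupp.sum_fintype _ _ (by simp)]
    simp⟩

theorem v_aeval_monomial (hv : ∀ j, Q.v (x j) = WithZero.exp (a j : ℤ)) {c : k} (hc : c ≠ 0)
    (u : Fin r →₀ ℕ) :
    Q.v (aeval x (monomial u c)) = WithZero.exp (monomialWeight a u : ℤ) := by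
  rw [aeval_monomial, map_mul, Q.trivial_on c hc, one_mul, Finsupp.prod_fintype _ _ (by simp),
    map_prod, monomialWeight]
  simp only [map_pow, hv]
  induction (Finset.univ : Finset (Fin r)) using Finset.cons_induction with
  | empty => simp
  | cons j s hj ih =>
    rw [Finset.prod_cons, ih, Finset.sum_cons, Nat.cast_add, WithZero.exp_add,
      ← WithZero.exp_nsmul]
    simp

/-- A function in `L(∞Q)` of pole order less than `n` is represented by a polynomial of weight
less than `n`. -/
theorem exists_polynomial_of_lt (hF : IsCurveFunctionField k F) (hQ : Q.IsRational)
    (ha : (AddSubmonoid.closure (Set.range a) : Set ℕ) = weierstrassSemigroup Q)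
    (hv : ∀ j, Q.v (x j) = WithZero.exp (a j : ℤ)) (hx : ∀ j, x j ∈ ringAtInfinity Q)
    (n : ℕ) {f : F} (hf : f ∈ ringAtInfinity Q) (hfn : Q.v f < WithZero.exp (n : ℤ)) :
    ∃ q : MvPolynomial (Fin r) k, aeval x q = f ∧ ∀ u ∈ q.support, monomialWeight a u < n := by
  classical
  induction n generalizing f with
  | zero =>
    exact ⟨0, by rw [map_zero, ringAtInfinity_eq_zero_of_lt_one hF hf (by simpa using hfn)],
      by simp⟩
  | succ n ih =>
    have hle : Q.v f ≤ WithZero.exp (n : ℤ) :=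
      WithZero.lt_exp_add_one_iff.1 (by exact_mod_cast hfn)
    by_cases heq : Q.v f = WithZero.exp (n : ℤ)
    · obtain ⟨u, hu⟩ := exists_monomialWeight_eq (a := a) (n := n) (by
        rw [← SetLike.mem_coe, ha]; exact mem_weierstrassSemigroup_iff.2 ⟨f, hf, heq⟩)
      have hvu := v_aeval_monomial hv (one_ne_zero (α := k)) u
      rw [hu] at hvu
      have hu0 : aeval x (monomial u (1 : k)) ≠ 0 :=
        Q.v.ne_zero_iff.1 (by rw [hvu]; exact WithZero.exp_ne_zero)
      obtain ⟨c, hc⟩ := hQ.exists_v_sub_lt hu0 (hle.trans hvu.ge)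
      have hmem : f - algebraMap k F c * aeval x (monomial u (1 : k)) ∈ ringAtInfinity Q :=
        sub_mem hf (mul_mem (Subalgebra.algebraMap_mem _ c)
          (coe_polyHom hx (monomial u (1 : k)) ▸ Subtype.prop _))
      obtain ⟨q, hq, hqs⟩ := ih hmem (hc.trans_eq hvu)
      refine ⟨q + C c * monomial u 1, by simp only [map_add, map_mul, hq, algHom_C, sub_add_cancel],
        fun w hw => ?_⟩
      rcases Finset.mem_union.1 (support_add hw) with h | h
      · exact (hqs w h).trans n.lt_succ_self
      · rw [C_mul_monomial] at h
        rw [Finset.mem_singleton.1 (support_monomial_subset h), hu]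
        exact n.lt_succ_self
    · obtain ⟨q, hq, hqs⟩ := ih hf (lt_of_le_of_ne hle heq)
      exact ⟨q, hq, fun u hu => (hqs u hu).trans n.lt_succ_self⟩

theorem exists_polynomial (hF : IsCurveFunctionField k F) (hQ : Q.IsRational)
    (ha : (AddSubmonoid.closure (Set.range a) : Set ℕ) = weierstrassSemigroup Q)
    (hv : ∀ j, Q.v (x j) = WithZero.exp (a j : ℤ)) (hx : ∀ j, x j ∈ ringAtInfinity Q)
    {f : F} (hf : f ∈ ringAtInfinity Q) : ∃ q : MvPolynomial (Fin r) k, aeval x q = f := by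
  obtain ⟨q, hq, -⟩ := exists_polynomial_of_lt hF hQ ha hv hx
    ((WithZero.log (Q.v f)).toNat + 1) hf (by
      rw [Nat.cast_add, Nat.cast_one, WithZero.lt_exp_add_one_iff]
      exact WithZero.le_exp_of_log_le (Int.self_le_toNat _))
  exact ⟨q, hq⟩

theorem MonomialOrder.not_mem_footprint (mo : MonomialOrder (Fin r))
    {J : Ideal (MvPolynomial (Fin r) k)} {u : Fin r →₀ ℕ} {q : MvPolynomial (Fin r) k}
    (hq : ∀ w ∈ q.support, mo.toSyn w < mo.toSyn u) (hJ : monomial u 1 - q ∈ J) :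
    u ∉ footprint mo J := by
  classical
  intro hu
  have hcoeff : coeff u (monomial u 1 - q) = 1 := by
    have : coeff u q = 0 := notMem_support_iff.1 fun h => lt_irrefl _ (hq u h)
    simp [this]
  have hmem : u ∈ (monomial u 1 - q).support := by
    rw [mem_support_iff, hcoeff]; exact one_ne_zero
  refine hu _ hJ (fun h0 => by rw [h0] at hmem; simp at hmem) (mo.toSyn.injective ?_)
  refine le_antisymm (mo.degree_le_iff.2 fun w hw => ?_) (mo.le_degree hmem)
  rcases Finset.mem_union.1 (support_sub _ _ _ hw) with h | h
  · rw [Finset.mem_singleton.1 (support_monomial_subset h)]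
  · exact (hq w h).le

/-- This choice, made without reference to a divisor, serves both footprints. Weights a_j = 0 are
allowed, so a weight may belong to infinitely many monomials; the minimum comes from
well-foundedness of the order. -/
theorem MonomialOrder.exists_minimal_monomials {mo : MonomialOrder (Fin r)} :
    ∃ μ : ℕ → (Fin r →₀ ℕ), ∀ n ∈ AddSubmonoid.closure (Set.range a),
      monomialWeight a (μ n) = n ∧
        ∀ w, monomialWeight a w = n → mo.toSyn (μ n) ≤ mo.toSyn w := by
  have h : ∀ n : ℕ, ∃ u : Fin r →₀ ℕ, n ∈ AddSubmonoid.closure (Set.range a) →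
      monomialWeight a u = n ∧ ∀ w, monomialWeight a w = n → mo.toSyn u ≤ mo.toSyn w := by
    intro n
    by_cases hn : n ∈ AddSubmonoid.closure (Set.range a)
    · obtain ⟨u, hu, hmin⟩ := (InvImage.wf mo.toSyn wellFounded_lt).has_min
        {u | monomialWeight a u = n} (exists_monomialWeight_eq hn)
      exact ⟨u, fun _ => ⟨hu, fun w hw => le_of_not_gt (hmin w hw)⟩⟩
    · exact ⟨0, fun h => absurd h hn⟩
  choose μ hμ using h
  exact ⟨μ, hμ⟩

end Generators

/-! ### The ideals ⟨I, f_z⟩ and their footprints -/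

namespace EvaluationSetup

open MvPolynomial

variable {k F : Type*} [Field k] [Field F] [Algebra k F] {Q : CurvePlace k F} {l : ℕ}
  {P : Fin l → CurvePlace k F} {z : F} (S : EvaluationSetup Q P z)
  {r : ℕ} {a : Fin r → ℕ} {x : Fin r → F} {fz : MvPolynomial (Fin r) k}
  (ha : (AddSubmonoid.closure (Set.range a) : Set ℕ) = weierstrassSemigroup Q)
  (hv : ∀ j, Q.v (x j) = WithZero.exp (a j : ℤ)) (hx : ∀ j, x j ∈ ringAtInfinity Q)
  (hfz : aeval x fz = z)
include S ha hv hx hfz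

/-- The cofactor g is itself represented by a polynomial q, and p - fz * q is then a relation
between the x_j. -/
theorem mem_relationIdealWith_iff (p : MvPolynomial (Fin r) k) :
    p ∈ relationIdealWith x fz ↔ ∃ g ∈ ringAtInfinity Q, aeval x p = z * g := by
  constructor
  · intro hp
    obtain ⟨p₁, h₁, p₂, h₂, rfl⟩ := Submodule.mem_sup.1 hp
    obtain ⟨q, rfl⟩ := Ideal.mem_span_singleton.1 h₂
    have h₁' : aeval x p₁ = 0 := h₁
    refine ⟨aeval x q, coe_polyHom hx q ▸ Subtype.prop _, ?_⟩
    rw [map_add, h₁', zero_add, map_mul, hfz]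
  · rintro ⟨g, hg, h⟩
    obtain ⟨q, rfl⟩ := exists_polynomial S.curve S.rational ha hv hx hg
    refine Submodule.mem_sup.2 ⟨p - fz * q, ?_, fz * q,
      Ideal.mul_mem_right _ _ (Ideal.mem_span_singleton_self fz), sub_add_cancel _ _⟩
    change aeval x (p - fz * q) = 0
    rw [map_sub, h, map_mul, hfz, sub_self]

theorem evalHom_polyHom_eq_zero_iff (p : MvPolynomial (Fin r) k) :
    S.evalHom (polyHom hx p) = 0 ↔ p ∈ relationIdealWith x fz := by
  rw [S.mem_relationIdealWith_iff ha hv hx hfz, S.evalHom_eq_zero_iff, coe_polyHom]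

theorem relationIdealWith_le {s : ℕ} {κ : Fin s → Fin l} {z' : F}
    (S' : EvaluationSetup Q (P ∘ κ) z') {fz' : MvPolynomial (Fin r) k} (hfz' : aeval x fz' = z') :
    relationIdealWith x fz ≤ relationIdealWith x fz' := by
  intro p hp
  obtain ⟨g, hg, h⟩ := (S.mem_relationIdealWith_iff ha hv hx hfz p).1 hp
  obtain ⟨y, hy, hzy⟩ := S.exists_eq_mul S'
  exact (S'.mem_relationIdealWith_iff ha hv hx hfz' p).2
    ⟨y * g, mul_mem hy hg, by rw [h, hzy, mul_assoc]⟩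

/-- The footprint consists of the monomials whose weight is in `H*(Q)` and that are the smallest
monomials of their weight. -/
theorem mem_footprint_iff {mo : MonomialOrder (Fin r)} (hmo : RefinesWeight mo a)
    (u : Fin r →₀ ℕ) :
    u ∈ footprint mo (relationIdealWith x fz) ↔ monomialWeight a u ∈ hStar P Q ∧
      ∀ w, monomialWeight a w = monomialWeight a u → mo.toSyn u ≤ mo.toSyn w := by
  classical
  have hmem : ∀ p : MvPolynomial (Fin r) k, aeval x p ∈ ringAtInfinity Q := fun p =>
    coe_polyHom hx p ▸ Subtype.prop _
  have hvu := v_aeval_monomial hv (one_ne_zero (α := k))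
  constructor
  · intro hu
    -- A function with the pole order of the monomial u agrees with it up to a constant factor and a
    -- polynomial of lower weight. With f = zg, or with f a smaller monomial of the same weight,
    -- this yields an element of the ideal with leading monomial u.
    have hreduce : ∀ f ∈ ringAtInfinity Q, Q.v f = WithZero.exp (monomialWeight a u : ℤ) →
        ∃ (c : k) (q : MvPolynomial (Fin r) k),
          aeval x (monomial u 1 - q) = algebraMap k F c * f ∧
            ∀ w ∈ q.support, monomialWeight a w < monomialWeight a u := by
      intro f hf hfu
      have hf0 : f ≠ 0 := Q.v.ne_zero_iff.1 (by rw [hfu]; exact WithZero.exp_ne_zero)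
      obtain ⟨c, hc⟩ := S.rational.exists_v_sub_lt hf0 ((hvu u).trans hfu.symm).le
      obtain ⟨q, hq, hqs⟩ := exists_polynomial_of_lt S.curve S.rational ha hv hx _
        (sub_mem (hmem _) (mul_mem (Subalgebra.algebraMap_mem _ c) hf)) (hc.trans_eq hfu)
      exact ⟨c, q, by rw [map_sub, hq, sub_sub_cancel], hqs⟩
    refine ⟨S.mem_hStar_iff.2
      ⟨mem_weierstrassSemigroup_iff.2 ⟨_, hmem _, hvu u⟩, fun n hn hnu => ?_⟩,
      fun w hw => le_of_not_gt fun hlt => ?_⟩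
    · obtain ⟨g, hg, hgn⟩ := mem_weierstrassSemigroup_iff.1 hn
      obtain ⟨c, q, hq, hqs⟩ := hreduce (z * g) (mul_mem S.z_mem hg) (by
        rw [map_mul, S.v_z_infinity, hgn, ← WithZero.exp_add, WithZero.exp_inj]; omega)
      refine mo.not_mem_footprint (fun w hw => hmo _ _ (hqs w hw)) ?_ hu
      exact (S.mem_relationIdealWith_iff ha hv hx hfz _).2 ⟨algebraMap k F c * g,
        mul_mem (Subalgebra.algebraMap_mem _ c) hg, by rw [hq]; ring⟩
    · obtain ⟨c, q, hq, hqs⟩ := hreduce _ (hmem _) ((hvu w).trans (by rw [hw]))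
      refine mo.not_mem_footprint (q := q + C c * monomial w 1) (fun t ht => ?_) ?_ hu
      · rcases Finset.mem_union.1 (support_add ht) with h | h
        · exact hmo _ _ (hqs t h)
        · rw [C_mul_monomial] at h
          rwa [Finset.mem_singleton.1 (support_monomial_subset h)]
      · refine (S.mem_relationIdealWith_iff ha hv hx hfz _).2 ⟨0, zero_mem _, ?_⟩
        rw [← sub_sub, map_sub, hq, map_mul, algHom_C, sub_self, mul_zero]
  · rintro ⟨hu, hmin⟩ p hp hp0 rfl
    have hlead := mo.degree_mem_support hp0
    -- Minimality of the leading monomial within its weight makes every other term of p strictly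
    -- lighter, so the pole order of p(x) is the leading weight. That weight lies in H*(Q), hence
    -- p(x) cannot evaluate to zero.
    have hvp : Q.v (aeval x p) = WithZero.exp (monomialWeight a (mo.degree p) : ℤ) := by
      have hval : ∀ w ∈ p.support, Q.v (aeval x (monomial w (coeff w p))) =
          WithZero.exp (monomialWeight a w : ℤ) := fun w hw =>
        v_aeval_monomial hv (mem_support_iff.1 hw) w
      rw [← hval _ hlead]
      conv_lhs => rw [p.as_sum, map_sum]
      refine Q.v.map_sum_eq_of_lt hlead fun w hw => ?_
      rw [Finset.mem_sdiff, Finset.mem_singleton] at hw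
      rw [hval _ hlead, hval _ hw.1, WithZero.exp_lt_exp, Nat.cast_lt]
      have hle := mo.le_degree hw.1
      refine lt_of_le_of_ne (le_of_not_gt fun h => absurd (hmo _ _ h) (not_lt.2 hle)) fun h => ?_
      exact hw.2 (mo.toSyn.injective (le_antisymm hle (hmin w h)))
    refine S.evalHom_ne_zero hu (f := polyHom hx p) (by rwa [coe_polyHom]) ?_
    exact (S.evalHom_polyHom_eq_zero_iff ha hv hx hfz p).2 hp

theorem isFootprintMatrix {mo : MonomialOrder (Fin r)} (hmo : RefinesWeight mo a)
    {μ : ℕ → (Fin r →₀ ℕ)} (hμ : ∀ n ∈ AddSubmonoid.closure (Set.range a),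
      monomialWeight a (μ n) = n ∧ ∀ w, monomialWeight a w = n → mo.toSyn (μ n) ≤ mo.toSyn w)
    {m : Fin l → ℕ} (hm : StrictMono m) (hrange : Set.range m = hStar P Q) :
    IsFootprintMatrix mo a x (relationIdealWith x fz) P
        (fun i => evalAt P (aeval x (monomial (μ (m i)) (1 : k)))) ∧
      IsKernel P Q (fun i => evalAt P (aeval x (monomial (μ (m i)) (1 : k)))) := by
  have hmem : ∀ n ∈ hStar P Q, n ∈ AddSubmonoid.closure (Set.range a) := fun n hn => by
    rw [← SetLike.mem_coe, ha]; exact (S.mem_hStar_iff.1 hn).1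
  have hmi : ∀ i, m i ∈ hStar P Q := fun i => hrange ▸ Set.mem_range_self i
  have hw : ∀ i, monomialWeight a (μ (m i)) = m i := fun i => (hμ _ (hmem _ (hmi i))).1
  refine ⟨⟨fun i => μ (m i), ?_, by simpa only [hw] using hm, fun i => rfl⟩, ?_⟩
  · ext u
    rw [S.mem_footprint_iff ha hv hx hfz hmo]
    constructor
    · rintro ⟨i, rfl⟩
      simp only [hw]
      exact ⟨hmi i, (hμ _ (hmem _ (hmi i))).2⟩
    · rintro ⟨hu, hmin⟩
      obtain ⟨h1, h2⟩ := hμ _ (hmem _ hu)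
      rw [← hrange] at hu
      obtain ⟨i, hi⟩ := hu
      refine ⟨i, mo.toSyn.injective ?_⟩
      simp only [hi]
      exact le_antisymm (h2 u rfl) (hmin _ h1)
  · refine S.isKernel_of_pole_orders hm hrange
      (f := fun i => polyHom hx (monomial (μ (m i)) 1)) (fun i => ?_) fun i => ?_
    · rw [coe_polyHom, v_aeval_monomial hv one_ne_zero, hw]
    · rw [evalHom_apply, coe_polyHom]

end EvaluationSetup

end

theorem mainTheorem12 {k F : Type*} [Field k] [Finite k] [Field F] [Algebra k F]
    (hF : IsCurveFunctionField k F)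
    -- the pointed curve, and the divisor `D = P₁ + ⋯ + Pₗ` of distinct rational points
    (Q : CurvePlace k F) (hQ : Q.IsRational)
    {l : ℕ} (P : Fin l → CurvePlace k F) (hP : ∀ i, (P i).IsRational)
    (hP_inj : Function.Injective P) (hPQ : ∀ i, P i ≠ Q)
    -- `(z) = D - lQ` and `(z') = D' - sQ` with `D' = P_{κ 1} + ⋯ + P_{κ s}`
    (z z' : F) (hz : HasDivisor z (pointsDivisor P - multDivisor (l : ℤ) Q))
    {s : ℕ} (κ : Fin s → Fin l) (hκ : Function.Injective κ)
    (hz' : HasDivisor z' (pointsDivisor (P ∘ κ) - multDivisor (s : ℤ) Q))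
    -- functions `x₁, …, xᵣ` in `L(∞Q)` whose pole orders `a₁, …, aᵣ` generate `H(Q)`
    {r : ℕ} (a : Fin r → ℕ) (x : Fin r → F)
    (ha : (AddSubmonoid.closure (Set.range a) : Set ℕ) = weierstrassSemigroup Q)
    (hx : ∀ j, x j ∈ ringAtInfinity Q ∧ x j ≠ 0 ∧ Q.ord (x j) = -(a j : ℤ))
    -- polynomials that represent `z` and `z'`
    (fz fz' : MvPolynomial (Fin r) k)
    (hfz : MvPolynomial.aeval x fz = z) (hfz' : MvPolynomial.aeval x fz' = z') :
    -- the commutative square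
    (∃ (ψ : (MvPolynomial (Fin r) k ⧸ relationIdealWith x fz) →ₐ[k]
          (MvPolynomial (Fin r) k ⧸ relationIdealWith x fz'))
        (evD : (MvPolynomial (Fin r) k ⧸ relationIdealWith x fz) →ₐ[k] (Fin l → k))
        (evD' : (MvPolynomial (Fin r) k ⧸ relationIdealWith x fz') →ₐ[k] (Fin s → k)),
      (∀ p, ψ (Ideal.Quotient.mk _ p) = Ideal.Quotient.mk _ p) ∧
      (∀ p, evD (Ideal.Quotient.mk _ p) = evalAt P (MvPolynomial.aeval x p)) ∧
      (∀ p, evD' (Ideal.Quotient.mk _ p) = evalAt (P ∘ κ) (MvPolynomial.aeval x p)) ∧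
      ∀ c, (fun i => evD c (κ i)) = evD' (ψ c)) ∧
    -- the kernels for `D'` are submatrices of the kernels for `D`
    ∃ rows : Fin s ↪o Fin l,
      (∀ G : Matrix (Fin l) (Fin l) k, IsKernel P Q G →
        IsKernel (P ∘ κ) Q (G.submatrix rows κ)) ∧
      (∀ G' : Matrix (Fin s) (Fin s) k, IsKernel (P ∘ κ) Q G' →
        ∃ G : Matrix (Fin l) (Fin l) k, IsKernel P Q G ∧ G' = G.submatrix rows κ) ∧
      -- the same for the kernels obtained from the footprints of `⟨I, f_z⟩` and `⟨I, f_{z'}⟩`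
      ∀ mo : MonomialOrder (Fin r), RefinesWeight mo a →
        ∃ (G : Matrix (Fin l) (Fin l) k) (G' : Matrix (Fin s) (Fin s) k),
          IsFootprintMatrix mo a x (relationIdealWith x fz) P G ∧ IsKernel P Q G ∧
          IsFootprintMatrix mo a x (relationIdealWith x fz') (P ∘ κ) G' ∧
          IsKernel (P ∘ κ) Q G' ∧ G' = G.submatrix rows κ := by
  have S : EvaluationSetup Q P z := ⟨hF, hQ, hP, hP_inj, hPQ, hz⟩
  have S' : EvaluationSetup Q (P ∘ κ) z' :=
    ⟨hF, hQ, fun i => hP (κ i), hP_inj.comp hκ, fun i => hPQ (κ i), hz'⟩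
  have hxA : ∀ j, x j ∈ ringAtInfinity Q := fun j => (hx j).1
  have hv : ∀ j, Q.v (x j) = WithZero.exp (a j : ℤ) := fun j =>
    (Q.ord_eq_neg_iff (hx j).2.1 _).1 (hx j).2.2
  refine ⟨⟨Ideal.Quotient.factorₐ k (S.relationIdealWith_le ha hv hxA hfz S' hfz'),
    Ideal.Quotient.liftₐ _ (S.evalHom.comp (polyHom hxA))
      (fun p hp => (S.evalHom_polyHom_eq_zero_iff ha hv hxA hfz p).2 hp),
    Ideal.Quotient.liftₐ _ (S'.evalHom.comp (polyHom hxA))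
      (fun p hp => (S'.evalHom_polyHom_eq_zero_iff ha hv hxA hfz' p).2 hp),
    fun p => rfl, fun p => ?_, fun p => ?_, fun c => ?_⟩, ?_⟩
  · exact congrArg (evalAt P) (coe_polyHom hxA p)
  · exact congrArg (evalAt (P ∘ κ)) (coe_polyHom hxA p)
  · obtain ⟨p, rfl⟩ := Ideal.Quotient.mk_surjective c
    rfl
  obtain ⟨m, hm, hrange⟩ := S.exists_enumeration
  obtain ⟨m', hm', hrange'⟩ := S'.exists_enumeration
  obtain ⟨rows, hrows⟩ := S.exists_rows S' hm hrange hm' hrange'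
  refine ⟨rows, fun G hG => S.isKernel_submatrix S' hm hrange hm' hrange' hrows hG,
    fun G' hG' => S.exists_isKernel_submatrix S' hm hrange hm' hrange' hrows hG',
    fun mo hmo => ?_⟩
  -- One μ for both divisors makes each row of G' use the same monomial as the corresponding row of
  -- G.
  obtain ⟨μ, hμ⟩ := MonomialOrder.exists_minimal_monomials (a := a) (mo := mo)
  obtain ⟨h1, h2⟩ := S.isFootprintMatrix ha hv hxA hfz hmo hμ hm hrange
  obtain ⟨h3, h4⟩ := S'.isFootprintMatrix ha hv hxA hfz' hmo hμ hm' hrange'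
  refine ⟨_, _, h1, h2, h3, h4, ?_⟩
  funext t u
  rw [← hrows]
  rfl
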